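/- Let $R$ be either a noetherian (commutative) local ring with maximal ideal $\mathfrak m$, or a (commutative) standard graded algebra over a field $k$, i.e. $R=\bigoplus_{i\ge 0}R_i$ with $R_0=k$, $\dim_k R_1<\infty$ and $R$ generated by $R_1$ as a $k$-algebra, with graded maximal ideal $\mathfrak m=\bigoplus_{i>0}R_i$. In the graded case all modules are $\mathbb Z$-graded, and all maps are homogeneous of degree $0$. For a finitely generated $R$-module $M$ with minimal free resolution $(F,\partial)$ (minimal graded free resolution in the graded case), filter $F$ by the subcomplexes $\mathcal G^nF$ with $(\mathcal G^nF)_i=\mathfrak m^{n-i}F_i$, where $\mathfrak m^j=R$ for $j\le 0$, and let $\operatorname{lin}^RF=\bigoplus_n\mathcal G^nF/\mathcal G^{n+1}F$ be the associated graded complex. The linearity defect of $M$ is $\sup\{i: H_i(\operatorname{lin}^RF)\ne 0\}$ (and $0$ if $M=0$); $M$ is called a Koszul module if its linearity defect is $0$. Write $\operatorname{pd}_R M$ for the projective dimension, and, in the graded case, $\operatorname{reg}_R M=\sup\{j-i: \operatorname{Tor}_i^R(k,M)_j\neq 0\}$ for the Castelnuovo–Mumford regularity. Both may be infinite. (1)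 Let $0\to M'\to P'\to N'\to 0$ be a short exact sequence of non-zero finitely generated $R$-modules such that $M'$ is a Koszul module and $M'\cap \mathfrak mP'=\mathfrak mM'$ (here $M'$ is identified with its image in $P'$). Then $$\operatorname{pd}_R P'=\max\{\operatorname{pd}_R M',\operatorname{pd}_R N'\},$$ and, in the graded case, also $$\operatorname{reg}_R P'=\max\{\operatorname{reg}_R M',\operatorname{reg}_R N'\}.$$ (2) Let $0\to M\to P\to N\to 0$ be a short exact sequence of non-zero finitely generated $R$-modules such that $P$ is a Koszul module and $M\subseteq \mathfrak mP$ (here $M$ is identified with its image in $P$). Then $$\operatorname{pd}_R N=\max\{\operatorname{pd}_R M+1,\operatorname{pd}_R P\},$$ and, in the graded case, also $$\operatorname{reg}_R N=\max\{\operatorname{reg}_R M-1,\operatorname{reg}_R P\}.$$ -/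

import Mathlib

open scoped TensorProduct

universe u v w

/-- The `i`-th cycles of a chain complex `⋯ ⟶ C 2 ⟶ C 1 ⟶ C 0 ⟶ 0` with differentials
`d i : C (i + 1) → C i` (the differential leaving `C 0` is zero). -/
def cyclesOf {R : Type u} [CommRing R] {C : ℕ → Type v} [∀ i, AddCommGroup (C i)]
    [∀ i, Module R (C i)] (d : ∀ i, C (i + 1) →ₗ[R] C i) : ∀ i, Submodule R (C i)
  | 0 => ⊤
  | i + 1 => LinearMap.ker (d i)

/-- The `i`-th homology module, cycles modulo boundaries, of a chain complex
`⋯ ⟶ C 2 ⟶ C 1 ⟶ C 0 ⟶ 0`. -/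
abbrev homologyOf {R : Type u} [CommRing R] {C : ℕ → Type v} [∀ i, AddCommGroup (C i)]
    [∀ i, Module R (C i)] (d : ∀ i, C (i + 1) →ₗ[R] C i) (i : ℕ) : Type v :=
  ↥(cyclesOf d i) ⧸ (LinearMap.range (d i)).submoduleOf (cyclesOf d i)

/-- A resolution of the `R`-module `M` by free modules of finite rank; the module in homological
degree `i` is the free module `ι i → R` on the finite set `ι i`. -/
structure FreeRes (R : Type u) [CommRing R] (M : Type v) [AddCommGroup M] [Module R M] where
  ι : ℕ → Type
  finite_index : ∀ i, Finite (ι i)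
  d : ∀ i, (ι (i + 1) → R) →ₗ[R] (ι i → R)
  aug : (ι 0 → R) →ₗ[R] M
  exact_succ : ∀ i, Function.Exact (d (i + 1)) (d i)
  exact_zero : Function.Exact (d 0) aug
  aug_surjective : Function.Surjective aug

namespace FreeRes

variable {R : Type u} [CommRing R] {M : Type v} [AddCommGroup M] [Module R M]

/-- The resolution is minimal with respect to the ideal `I` (in practice the maximal ideal of a
local ring, or the graded maximal ideal): each differential maps `F (i + 1)` into `I F i`. -/
def IsMinimal (F : FreeRes R M) (I : Ideal R) : Prop :=
  ∀ i, LinearMap.range (F.d i) ≤ I • (⊤ : Submodule R (F.ι i → R))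

/-- The filtration `(𝒢ⁿ F)_i = Iⁿ⁻ⁱ F_i`, where `Iʲ = R` for `j ≤ 0` (this is what truncated
subtraction gives). -/
def filt (F : FreeRes R M) (I : Ideal R) (n i : ℕ) : Submodule R (F.ι i → R) :=
  I ^ (n - i) • (⊤ : Submodule R (F.ι i → R))

theorem d_mem_filt (F : FreeRes R M) {I : Ideal R} (hF : F.IsMinimal I) (n i : ℕ) :
    ∀ x ∈ F.filt I n (i + 1), F.d i x ∈ F.filt I n i := by
  intro x hx
  unfold filt at hx ⊢
  rcases Nat.lt_or_ge i n with h | h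
  · have h1 : n - i = (n - (i + 1)) + 1 := by omega
    have h2 : F.d i x ∈ (I ^ (n - (i + 1)) • (⊤ : Submodule R (F.ι (i + 1) → R))).map (F.d i) :=
      Submodule.mem_map_of_mem hx
    rw [Submodule.map_smul'', Submodule.map_top] at h2
    rw [h1, pow_succ, Submodule.mul_smul]
    exact Submodule.smul_mono le_rfl (hF i) h2
  · rw [Nat.sub_eq_zero_of_le h, pow_zero, Ideal.one_eq_top, Submodule.top_smul]
    exact Submodule.mem_top

/-- The component `(𝒢ⁿ F)_i / (𝒢ⁿ⁺¹ F)_i` of the linear part of `F`. -/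
abbrev linPart (F : FreeRes R M) (I : Ideal R) (n i : ℕ) : Type u :=
  ↥(F.filt I n i) ⧸ (F.filt I (n + 1) i).submoduleOf (F.filt I n i)

/-- The differential of the linear part, induced by the differential of `F`. -/
def linPartD (F : FreeRes R M) {I : Ideal R} (hF : F.IsMinimal I) (n i : ℕ) :
    F.linPart I n (i + 1) →ₗ[R] F.linPart I n i :=
  Submodule.mapQ _ _ ((F.d i).restrict (F.d_mem_filt hF n i))
    (fun x hx => F.d_mem_filt hF (n + 1) i x.1 hx)

/-- `H_i (lin F) ≠ 0`, where `lin F` is the direct sum over `n` of the complexes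
`(𝒢ⁿ F) / (𝒢ⁿ⁺¹ F)`. -/
def LinHomologyNeZero (F : FreeRes R M) {I : Ideal R} (hF : F.IsMinimal I) (i : ℕ) : Prop :=
  ∃ n : ℕ, Nontrivial (homologyOf (R := R) (C := fun l => F.linPart I n l) (fun l => F.linPartD hF n l) i)

/-- The differential of the complex `R/I ⊗ F`. -/
def residueD (F : FreeRes R M) (I : Ideal R) (i : ℕ) :
    (R ⧸ I) ⊗[R] (F.ι (i + 1) → R) →ₗ[R] (R ⧸ I) ⊗[R] (F.ι i → R) :=
  (F.d i).lTensor (R ⧸ I)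

/-- `Tor_i (R/I, M)`, computed from the free resolution `F` of `M`. -/
abbrev tor (F : FreeRes R M) (I : Ideal R) (i : ℕ) : Type u :=
  homologyOf (C := fun l => (R ⧸ I) ⊗[R] (F.ι l → R)) (fun l => F.residueD I l) i

end FreeRes

/-- The linearity defect `sup {i : H_i (lin F) ≠ 0}` of a finitely generated module `M` over a
noetherian local ring, where `F` is the minimal free resolution of `M`. (The minimal free
resolution is unique up to isomorphism, so it does not matter which one is used. The supremum of
the empty set in `ℕ∞` is `0`, the conventional value for the zero module.) -/
noncomputable def linDefect (R : Type u) [CommRing R] [IsLocalRing R] (M : Type v)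
    [AddCommGroup M] [Module R M] : ℕ∞ :=
  sSup {l | ∃ (F : FreeRes R M) (hF : F.IsMinimal (IsLocalRing.maximalIdeal R)) (i : ℕ),
    F.LinHomologyNeZero hF i ∧ l = (i : ℕ∞)}

/-- Koszul modules over a noetherian local ring. -/
def IsKoszulModule (R : Type u) [CommRing R] [IsLocalRing R] (M : Type v)
    [AddCommGroup M] [Module R M] : Prop :=
  linDefect R M = 0

/-- `R = ⨁ 𝒜 i` is a standard graded `k`-algebra: it is nonzero and nonnegatively graded,
`𝒜 0 = k`, and it is generated as a `k`-algebra by the finite-dimensional space `𝒜 1`. -/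
structure IsStandardGraded {k : Type w} [Field k] {R : Type u} [CommRing R] [Algebra k R]
    (𝒜 : ℤ → Submodule k R) [GradedAlgebra 𝒜] : Prop where
  nontrivial : Nontrivial R
  neg : ∀ i < 0, 𝒜 i = ⊥
  zero : 𝒜 0 = LinearMap.range (Algebra.linearMap k R)
  finite_one : Module.Finite k (𝒜 1)
  adjoin_one : Algebra.adjoin k (𝒜 1 : Set R) = ⊤

section Graded

variable {k : Type w} [Field k] {R : Type u} [CommRing R] [Algebra k R]

/-- The graded maximal ideal, generated by the homogeneous elements of positive degree. -/
def gradedMaxIdeal (𝒜 : ℤ → Submodule k R) : Ideal R :=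
  Ideal.span {x | ∃ i : ℤ, 0 < i ∧ x ∈ 𝒜 i}

/-- The component of degree `j` of the graded free module `⨁ e, R(-a e)`, whose basis element
with index `e` has degree `a e`. -/
def freePiece (𝒜 : ℤ → Submodule k R) {ι : Type} (a : ι → ℤ) (j : ℤ) : AddSubgroup (ι → R) where
  carrier := {x | ∀ e, x e ∈ 𝒜 (j - a e)}
  zero_mem' := fun _ => Submodule.zero_mem _
  add_mem' := fun hx hy e => Submodule.add_mem _ (hx e) (hy e)
  neg_mem' := fun hx e => Submodule.neg_mem _ (hx e)

variable {M : Type v} [AddCommGroup M] [Module R M]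

/-- A graded free resolution of the graded module `M = ⨁ ℳ j`: the free modules carry gradings
for which all maps are homogeneous of degree `0`. -/
structure GradedFreeRes (𝒜 : ℤ → Submodule k R) (ℳ : ℤ → AddSubgroup M) extends
    FreeRes R M where
  deg : ∀ i, ι i → ℤ
  d_mem : ∀ (i : ℕ) (j : ℤ), ∀ x ∈ freePiece 𝒜 (deg (i + 1)) j, d i x ∈ freePiece 𝒜 (deg i) j
  aug_mem : ∀ j : ℤ, ∀ x ∈ freePiece 𝒜 (deg 0) j, aug x ∈ ℳ j

/-- The linearity defect of a finitely generated graded module over a standard graded algebra,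
computed from the minimal graded free resolution. -/
noncomputable def gradedLinDefect (𝒜 : ℤ → Submodule k R) (ℳ : ℤ → AddSubgroup M) : ℕ∞ :=
  sSup {l | ∃ (F : GradedFreeRes 𝒜 ℳ) (hF : F.toFreeRes.IsMinimal (gradedMaxIdeal 𝒜)) (i : ℕ),
    F.toFreeRes.LinHomologyNeZero hF i ∧ l = (i : ℕ∞)}

/-- Koszul modules over a standard graded algebra. -/
def IsGradedKoszulModule (𝒜 : ℤ → Submodule k R) (ℳ : ℤ → AddSubgroup M) : Prop :=
  gradedLinDefect 𝒜 ℳ = 0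

/-- The component of degree `j` of `Tor_i (k, M)`, where `k = R/𝔪`, computed from the graded free
resolution `F` of `M`: the classes of cycles that lie in the component `(k ⊗ F_i)_j`, the image
of `(F_i)_j`. -/
def GradedFreeRes.torPiece {𝒜 : ℤ → Submodule k R} {ℳ : ℤ → AddSubgroup M}
    (F : GradedFreeRes 𝒜 ℳ) (i : ℕ) (j : ℤ) :
    AddSubgroup (F.toFreeRes.tor (gradedMaxIdeal 𝒜) i) :=
  (((freePiece 𝒜 (F.deg i) j).map
    (TensorProduct.mk R (R ⧸ gradedMaxIdeal 𝒜) (F.ι i → R) 1).toAddMonoidHom).comap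
    (Submodule.subtype _).toAddMonoidHom).map (Submodule.mkQ _).toAddMonoidHom

/-- The Castelnuovo-Mumford regularity `sup {j - i : Tor_i (k, M)_j ≠ 0}` of a finitely generated
graded module over a standard graded algebra, as an extended real number. (`Tor` does not depend
on the graded free resolution that it is computed from.) -/
noncomputable def regularity (𝒜 : ℤ → Submodule k R) (ℳ : ℤ → AddSubgroup M) : EReal :=
  sSup {r | ∃ (F : GradedFreeRes 𝒜 ℳ) (i : ℕ) (j : ℤ),
    F.torPiece i j ≠ ⊥ ∧ r = (((j - (i : ℤ) : ℤ) : ℝ) : EReal)}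

end Graded

/-- The projective dimension of a module. -/
noncomputable abbrev projDim (R : Type u) [CommRing R] (M : Type u) [AddCommGroup M]
    [Module R M] : WithBot ℕ∞ :=
  CategoryTheory.projectiveDimension (ModuleCat.of R M)

/-! Write 𝔪 for the maximal ideal and let F be the minimal free resolution of the Koszul module.
Vanishing of the positive homology of its linear part gives strictness, 𝔪²F_i ∩ im d ⊆ d(𝔪F_{i+1})
(`FreeRes.isStrict_of_linHomology`). Hence a map θ₀ from a minimal complex C to F with image in 𝔪F₀
extends to all degrees with images in 𝔪F: at each stage θd has image in 𝔪²F_i ∩ im d, so it lifts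
into 𝔪F_{i+1} (`exists_chain_lift`).

Such a θ, lowering degree by one and anticommuting with the differentials, twists the differential
of F ⊕ C, and the result is again minimal because all blocks have entries in 𝔪. For the pure
extension, C is the minimal resolution of N', and purity puts θ₀ into 𝔪F₀
(`exists_homogRes_of_pure`). For the small inclusion, C is the minimal resolution of M shifted by
one, θ₀ lifts M → P, and M ⊆ 𝔪P puts it into 𝔪F₀ (`exists_homogRes_of_small`). So the bases of two
minimal resolutions together form a basis of the third, degree by degree.

Finally, projective dimension is the length of a minimal resolution
(`FreeRes.hasProjectiveDimensionLT_iff`), and regularity is read off from the degrees of its basis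
(`regularity_eq`), so both formulas are comparisons of bases. A local ring is treated as graded in
degree 0, so one argument serves both settings. -/

/-- A `ℤ`-grading of an abelian group, given by its projections onto the graded components. -/
structure HomogProj (M : Type*) [AddCommGroup M] where
  p : ℤ → M →+ M
  orth : ∀ i j x, p i (p j x) = if i = j then p j x else 0
  exists_sum : ∀ x, ∃ s : Finset ℤ, ∑ j ∈ s, p j x = x

/-! ### Gradings described by projections -/

namespace HomogProj

theorem p_p {M : Type*} [AddCommGroup M] (g : HomogProj M) (i : ℤ) (x : M) :
    g.p i (g.p i x) = g.p i x := by
  simp [g.orth]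

theorem p_eq_zero {M : Type*} [AddCommGroup M] (g : HomogProj M) {i j : ℤ} (h : i ≠ j) {x : M}
    (hx : g.p j x = x) : g.p i x = 0 := by
  rw [← hx, g.orth, if_neg h]

theorem exists_superset_sum {M : Type*} [AddCommGroup M] (g : HomogProj M) (x : M) :
    ∃ s : Finset ℤ, ∀ t, s ⊆ t → ∑ j ∈ t, g.p j x = x := by
  obtain ⟨s, hs⟩ := g.exists_sum x
  refine ⟨s, fun t hst => ?_⟩
  rw [← Finset.sum_subset hst, hs]
  intro i _ hi
  rw [← hs, map_sum]
  refine Finset.sum_eq_zero fun j hj => ?_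
  rw [g.orth, if_neg]
  rintro rfl
  exact hi hj

section

variable {R : Type u} [CommRing R] {M : Type*} [AddCommGroup M] [Module R M]
  {N : Type*} [AddCommGroup N] [Module R N]

/-- A linear map is homogeneous of degree `0`. -/
def Homog (gM : HomogProj M) (gN : HomogProj N) (f : M →ₗ[R] N) : Prop :=
  ∀ j x, f (gM.p j x) = gN.p j (f x)

/-- A submodule is homogeneous. -/
def Stable (gM : HomogProj M) (K : Submodule R M) : Prop :=
  ∀ j x, x ∈ K → gM.p j x ∈ K

/-- The scalar multiplication is compatible with the gradings. -/
def Compat (gR : HomogProj R) (gM : HomogProj M) : Prop :=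
  ∀ i j (r : R) (x : M), gM.p j x = x → gM.p (i + j) (r • x) = gR.p i r • x

theorem mem_of_p_mem {gM : HomogProj M} {K : Submodule R M} {x : M} (h : ∀ j, gM.p j x ∈ K) :
    x ∈ K := by
  obtain ⟨s, hs⟩ := gM.exists_sum x
  rw [← hs]
  exact Submodule.sum_mem _ fun j _ => h j

theorem homog_of_forall {gM : HomogProj M} {gN : HomogProj N} {f : M →ₗ[R] N}
    (h : ∀ j x, gM.p j x = x → gN.p j (f x) = f x) : Homog gM gN f := by
  intro j x
  obtain ⟨s, hs⟩ := gM.exists_superset_sum x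
  have h1 := hs (insert j s) (Finset.subset_insert _ _)
  conv_rhs => rw [← h1]
  rw [map_sum, map_sum, Finset.sum_eq_single j]
  · rw [h _ _ (gM.p_p j x)]
  · intro i _ hi
    exact gN.p_eq_zero hi.symm (h _ _ (gM.p_p i x))
  · intro h; simp at h

theorem Homog.comp {L : Type*} [AddCommGroup L] [Module R L] {gM : HomogProj M} {gN : HomogProj N}
    {gL : HomogProj L} {f : M →ₗ[R] N} {h : N →ₗ[R] L} (hh : Homog gN gL h) (hf : Homog gM gN f) :
    Homog gM gL (h ∘ₗ f) := by
  intro j x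
  simp only [LinearMap.comp_apply]
  rw [hf, hh]

theorem Homog.neg {gM : HomogProj M} {gN : HomogProj N} {f : M →ₗ[R] N} (hf : Homog gM gN f) :
    Homog gM gN (-f) := by
  intro j x
  simp [hf j x]

theorem Homog.add {gM : HomogProj M} {gN : HomogProj N} {f h : M →ₗ[R] N} (hf : Homog gM gN f)
    (hh : Homog gM gN h) : Homog gM gN (f + h) := by
  intro j x
  simp [hf j x, hh j x]

theorem Homog.stable_ker {gM : HomogProj M} {gN : HomogProj N} {f : M →ₗ[R] N}
    (hf : Homog gM gN f) : Stable gM (LinearMap.ker f) := by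
  intro j x hx
  rw [LinearMap.mem_ker] at hx ⊢
  rw [hf, hx, map_zero]

theorem stable_top (gM : HomogProj M) : Stable gM (⊤ : Submodule R M) :=
  fun _ _ _ => Submodule.mem_top

/-- The grading of the free module whose basis element `e` has degree `a e`. -/
def free (gR : HomogProj R) {ι : Type} [Finite ι] (a : ι → ℤ) : HomogProj (ι → R) where
  p j := { toFun := fun x e => gR.p (j - a e) (x e)
           map_zero' := by ext; simp
           map_add' := by intros; ext; simp }
  orth i j x := by
    funext e
    by_cases h : i = j
    · simp [h, gR.p_p]
    · simp [h, gR.orth]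
  exists_sum x := by
    classical
    cases nonempty_fintype ι
    choose s hs using fun e => gR.exists_superset_sum (x e)
    refine ⟨Finset.univ.biUnion fun e => (s e).image (· + a e), ?_⟩
    funext e
    simp only [AddMonoidHom.coe_mk, ZeroHom.coe_mk, Finset.sum_apply]
    -- A single finite set must serve every coordinate: translated back by `a e`, it still contains
    -- `s e`.
    refine Eq.trans ?_ (hs e ((Finset.univ.biUnion fun e => (s e).image (· + a e)).image (· - a e)) ?_)
    · rw [Finset.sum_image]
      intro i _ j _ h
      simpa using h
    · intro i hi
      simp only [Finset.mem_image, Finset.mem_biUnion, Finset.mem_univ, true_and]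
      exact ⟨i + a e, ⟨e, i, hi, rfl⟩, by ring⟩

theorem free_p_apply (gR : HomogProj R) {ι : Type} [Finite ι] (a : ι → ℤ) (j : ℤ) (x : ι → R)
    (e : ι) : (free gR a).p j x e = gR.p (j - a e) (x e) := rfl

end

end HomogProj

theorem mem_smul_top_pi {R : Type*} [CommRing R] {ι : Type*} [Finite ι] {I : Ideal R} {x : ι → R} :
    x ∈ I • (⊤ : Submodule R (ι → R)) ↔ ∀ e, x e ∈ I := by
  classical
  cases nonempty_fintype ι
  constructor
  · intro hx e
    have := Submodule.mem_map_of_mem (f := LinearMap.proj (R := R) (φ := fun _ : ι => R) e) hx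
    rw [Submodule.map_smul''] at this
    exact Ideal.mul_le_left (I := I) this
  · intro h
    rw [pi_eq_sum_univ' x]
    exact Submodule.sum_mem _ fun e _ => Submodule.smul_mem_smul (h e) Submodule.mem_top

/-! ### Homogeneous lifting and minimal covers over graded-local rings -/

open HomogProj

/-- A graded ring with a proper homogeneous ideal `I` such that the elements of degree `0` that are
not in `I` are units, and all elements of other degrees are in `I`. Local rings (concentrated in
degree `0`) and standard graded algebras are examples. -/
structure GradedLocal {R : Type u} [CommRing R] (gR : HomogProj R) (I : Ideal R) : Prop where
  compat : Compat gR gR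
  one : gR.p 0 1 = 1
  ne_top : I ≠ ⊤
  stable : Stable gR I
  isUnit : ∀ r, gR.p 0 r ∈ I ∨ IsUnit (gR.p 0 r)
  mem : ∀ i, i ≠ 0 → ∀ r, gR.p i r ∈ I

section

variable {R : Type u} [CommRing R] {gR : HomogProj R} {M : Type*} [AddCommGroup M] [Module R M]
  {gM : HomogProj M}

theorem HomogProj.Compat.free (h : Compat gR gR) {ι : Type} [Finite ι] (a : ι → ℤ) :
    Compat gR (HomogProj.free gR a) := by
  intro i j r x hx
  funext e
  have h1 : gR.p (j - a e) (x e) = x e := congrFun hx e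
  have h2 := h i _ r _ h1
  rw [free_p_apply, add_sub_assoc]
  exact h2

theorem free_single (h1 : gR.p 0 1 = 1) {ι : Type} [Finite ι] [DecidableEq ι] (a : ι → ℤ) (e : ι) :
    (free gR a).p (a e) (Pi.single e 1) = Pi.single e 1 := by
  funext e'
  rw [free_p_apply]
  by_cases h : e' = e
  · subst h; simp [h1]
  · simp [h]

theorem homog_linearCombination (h : Compat gR gM) {ι : Type} [Fintype ι] (a : ι → ℤ) (v : ι → M)
    (hv : ∀ e, gM.p (a e) (v e) = v e) : Homog (free gR a) gM (Fintype.linearCombination R v) := by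
  intro j x
  simp only [Fintype.linearCombination_apply, free_p_apply, map_sum]
  refine Finset.sum_congr rfl fun e _ => ?_
  rw [← h _ _ _ _ (hv e), sub_add_cancel]

theorem stable_smul_top_free {I : Ideal R} (hI : Stable gR I) {ι : Type} [Finite ι] (a : ι → ℤ) :
    Stable (free gR a) (I • (⊤ : Submodule R (ι → R))) := by
  intro j x hx
  rw [mem_smul_top_pi] at hx ⊢
  exact fun e => hI _ _ (hx e)

/-- Homogeneous maps out of graded free modules lift along homogeneous maps. -/
theorem exists_homog_lift (h1 : gR.p 0 1 = 1) {ι : Type} [Finite ι] (a : ι → ℤ)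
    {F : Type*} [AddCommGroup F] [Module R F] {gF : HomogProj F} (hF : Compat gR gF)
    {h : (ι → R) →ₗ[R] M} (hh : Homog (free gR a) gM h) {d : F →ₗ[R] M} (hd : Homog gF gM d)
    {S : Submodule R F} (hS : Stable gF S) (hr : LinearMap.range h ≤ S.map d) :
    ∃ f : (ι → R) →ₗ[R] F, Homog (free gR a) gF f ∧ LinearMap.range f ≤ S ∧ d ∘ₗ f = h := by
  classical
  cases nonempty_fintype ι
  have h2 : ∀ e, ∃ x ∈ S, d x = h (Pi.single e 1) := fun e => hr ⟨_, rfl⟩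
  choose x hxS hx using h2
  refine ⟨Fintype.linearCombination R fun e => gF.p (a e) (x e),
    homog_linearCombination hF a _ fun e => gF.p_p _ _, ?_, ?_⟩
  · rw [Fintype.range_linearCombination, Submodule.span_le]
    rintro _ ⟨e, rfl⟩
    exact hS _ _ (hxS e)
  · refine LinearMap.pi_ext' fun e => LinearMap.ext_ring ?_
    simp only [LinearMap.comp_apply, LinearMap.single_apply, Fintype.linearCombination_apply_single,
      one_smul]
    rw [hd, hx, ← hh, free_single h1]

/-- A finitely generated homogeneous submodule is generated by finitely many homogeneous
elements. -/
theorem exists_homog_generators {K : Submodule R M} (hK : Stable gM K) (hfg : K.FG) :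
    ∃ (n : ℕ) (a : Fin n → ℤ) (v : Fin n → M), (∀ e, gM.p (a e) (v e) = v e) ∧
      Submodule.span R (Set.range v) = K := by
  classical
  obtain ⟨T, hT⟩ := hfg
  choose s hs using gM.exists_sum
  let J := Σ x : T, s x
  let e := (Fintype.equivFin J).symm
  refine ⟨Fintype.card J, fun i => (e i).2, fun i => gM.p (e i).2 (e i).1, fun i => gM.p_p _ _, ?_⟩
  apply le_antisymm
  · rw [Submodule.span_le]
    rintro _ ⟨i, rfl⟩
    refine hK _ _ ?_
    rw [← hT]
    exact Submodule.subset_span (e i).1.2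
  · rw [← hT, Submodule.span_le]
    intro x hx
    rw [← hs x]
    refine Submodule.sum_mem _ fun j hj => Submodule.subset_span ⟨e.symm ⟨⟨x, hx⟩, ⟨j, hj⟩⟩, ?_⟩
    exact congrArg (fun z : J => gM.p z.2 z.1) (e.apply_symm_apply _)

/-- A finitely generated homogeneous submodule has a minimal homogeneous free cover. -/
theorem exists_minimal_cover {I : Ideal R} (hR : GradedLocal gR I) (hM : Compat gR gM)
    {K : Submodule R M} (hK : Stable gM K) (hfg : K.FG) :
    ∃ (n : ℕ) (a : Fin n → ℤ) (d : (Fin n → R) →ₗ[R] M), Homog (free gR a) gM d ∧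
      LinearMap.range d = K ∧ LinearMap.ker d ≤ I • ⊤ := by
  classical
  -- Minimality of the cover comes from taking the least possible number of homogeneous generators.
  have hex := exists_homog_generators hK hfg
  obtain ⟨a, v, hv, hspan⟩ := Nat.find_spec hex
  have hmin := fun m => Nat.find_min hex (m := m)
  revert hmin a v
  generalize Nat.find hex = n
  intro a v hv hspan hmin
  have hd := homog_linearCombination hM a v hv
  refine ⟨n, a, Fintype.linearCombination R v, hd, ?_, ?_⟩
  · rw [Fintype.range_linearCombination, hspan]
  intro x hx
  rw [mem_smul_top_pi]
  intro e
  refine mem_of_p_mem (gM := gR) fun i => ?_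
  by_cases hi : i ≠ 0
  · exact hR.mem i hi _
  push Not at hi
  subst hi
  refine (hR.isUnit (x e)).resolve_right fun hu => ?_
  -- Passing to the component of degree `a e` keeps the relation and replaces its coefficient at `e`
  -- by the degree 0 part of `x e`. If that is a unit, the generator `v e` is redundant,
  -- contradicting the choice of `n`.
  have hy := hd.stable_ker (a e) x hx
  set y := (free gR a).p (a e) x with hydef
  have hye : y e = gR.p 0 (x e) := by rw [hydef, free_p_apply, sub_self]
  rw [← hye] at hu
  obtain ⟨m, rfl⟩ : ∃ m, n = m + 1 := ⟨n - 1, by have := e.2; omega⟩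
  rw [LinearMap.mem_ker, Fintype.linearCombination_apply, Fin.sum_univ_succAbove _ e] at hy
  refine hmin m (Nat.lt_succ_self m) ⟨a ∘ e.succAbove, v ∘ e.succAbove, fun i => hv _, ?_⟩
  have hle : Submodule.span R (Set.range (v ∘ e.succAbove)) ≤ Submodule.span R (Set.range v) :=
    Submodule.span_mono (Set.range_comp_subset_range _ _)
  rw [← hspan]
  refine le_antisymm hle ?_
  rw [Submodule.span_le]
  rintro _ ⟨i, rfl⟩
  rcases Fin.eq_self_or_eq_succAbove e i with rfl | ⟨i', rfl⟩
  · obtain ⟨c, hc⟩ := hu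
    rw [← hc] at hy
    have h3 : (c : R) • v i ∈ Submodule.span R (Set.range (v ∘ i.succAbove)) := by
      rw [eq_neg_of_add_eq_zero_left hy]
      exact Submodule.neg_mem _ (Submodule.sum_mem _ fun j _ => Submodule.smul_mem _ _
        (Submodule.subset_span ⟨j, rfl⟩))
    have h4 := Submodule.smul_mem _ (c⁻¹ : Rˣ).val h3
    rwa [smul_smul, Units.inv_mul, one_smul] at h4
  · exact Submodule.subset_span ⟨i', rfl⟩

end

-- Graded free resolutions

attribute [instance] FreeRes.finite_index

/-- Dependent choice with an invariant `P` carried along; it builds resolutions, chain maps and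
homotopies one degree at a time. -/
theorem exists_seq_of_step {α : ℕ → Type*} (P : ∀ i, α i → Prop) (Q : ∀ i, α i → α (i + 1) → Prop)
    (x : α 0) (hx : P 0 x) (hs : ∀ i x, P i x → ∃ y, P (i + 1) y ∧ Q i x y) :
    ∃ f : ∀ i, α i, f 0 = x ∧ (∀ i, P i (f i)) ∧ ∀ i, Q i (f i) (f (i + 1)) := by
  choose next hP hQ using hs
  let f : ∀ i, {x : α i // P i x} := fun i =>
    Nat.rec ⟨x, hx⟩ (fun i y => ⟨next i y.1 y.2, hP i y.1 y.2⟩) i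
  exact ⟨fun i => (f i).1, rfl, fun i => (f i).2, fun i => hQ i (f i).1 (f i).2⟩

section

variable {R : Type u} [CommRing R] {gR : HomogProj R}

/-- A graded free resolution. -/
structure HomogRes (gR : HomogProj R) {M : Type v} [AddCommGroup M] [Module R M]
    (gM : HomogProj M) extends FreeRes R M where
  deg : ∀ i, ι i → ℤ
  d_homog : ∀ i, Homog (free gR (deg (i + 1))) (free gR (deg i)) (d i)
  aug_homog : Homog (free gR (deg 0)) gM aug

/-- The `i`-th module of a graded free resolution has a basis element of degree `j`. -/
def HomogRes.HasDeg {M : Type v} [AddCommGroup M] [Module R M] {gM : HomogProj M}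
    (F : HomogRes gR gM) (i : ℕ) (j : ℤ) : Prop :=
  ∃ e, F.deg i e = j

/-- A complex of graded free modules of finite rank. -/
structure HomogComplex (gR : HomogProj R) where
  κ : ℕ → Type
  finite_index : ∀ i, Finite (κ i)
  d : ∀ i, (κ (i + 1) → R) →ₗ[R] (κ i → R)
  d_comp : ∀ i, d i ∘ₗ d (i + 1) = 0
  deg : ∀ i, κ i → ℤ
  d_homog : ∀ i, Homog (free gR (deg (i + 1))) (free gR (deg i)) (d i)

attribute [instance] HomogComplex.finite_index

theorem LinearMap.comp_eq_zero_of_exact {M N L : Type*} [AddCommGroup M] [AddCommGroup N]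
    [AddCommGroup L] [Module R M] [Module R N] [Module R L] {f : M →ₗ[R] N} {g : N →ₗ[R] L}
    (h : Function.Exact f g) : g ∘ₗ f = 0 :=
  LinearMap.ext fun x => (h (f x)).2 ⟨x, rfl⟩

/-- Finitely generated graded modules have minimal graded free resolutions. -/
theorem exists_minimal_homogRes [IsNoetherianRing R] {I : Ideal R} (hR : GradedLocal gR I)
    {M : Type v} [AddCommGroup M] [Module R M] [Module.Finite R M] {gM : HomogProj M}
    (hM : Compat gR gM) : ∃ F : HomogRes gR gM, F.IsMinimal I := by
  -- The recursion remembers the rank, the degrees of the basis and the syzygy submodule still to be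
  -- covered.
  let α := Σ' (n : ℕ) (a : Fin n → ℤ), Submodule R (Fin n → R)
  let P : α → Prop := fun S => Stable (free gR S.2.1) S.2.2 ∧ S.2.2 ≤ I • ⊤
  let Q : α → α → Prop := fun S T => ∃ d : (Fin T.1 → R) →ₗ[R] (Fin S.1 → R),
    Homog (free gR T.2.1) (free gR S.2.1) d ∧ LinearMap.range d = S.2.2 ∧
      LinearMap.ker d = T.2.2
  obtain ⟨n, a, d, hd, hr, hk⟩ := exists_minimal_cover hR hM (stable_top gM) Module.Finite.fg_top
  obtain ⟨S, hS0, hP, hQ⟩ := exists_seq_of_step (α := fun _ => α) (fun _ => P) (fun _ => Q)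
    ⟨n, a, LinearMap.ker d⟩ ⟨hd.stable_ker, hk⟩ (fun _ S hS => by
      obtain ⟨m, b, f, hf, hr, hk⟩ := exists_minimal_cover hR (Compat.free hR.compat S.2.1) hS.1
        (IsNoetherian.noetherian _)
      exact ⟨⟨m, b, LinearMap.ker f⟩, ⟨hf.stable_ker, hk⟩, f, hf, hr, rfl⟩)
  choose f hf hfr hfk using hQ
  obtain ⟨aug, haug, hr, hk⟩ : ∃ aug : (Fin (S 0).1 → R) →ₗ[R] M,
      Homog (free gR (S 0).2.1) gM aug ∧ LinearMap.range aug = ⊤ ∧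
        LinearMap.ker aug = (S 0).2.2 := by
    rw [hS0]; exact ⟨d, hd, hr, rfl⟩
  exact ⟨{ ι := fun i => Fin (S i).1
           finite_index := fun i => inferInstance
           d := f
           aug := aug
           exact_succ := fun i => LinearMap.exact_iff.2 (by rw [hfk, hfr])
           exact_zero := LinearMap.exact_iff.2 (by rw [hk, hfr])
           aug_surjective := LinearMap.range_eq_top.1 hr
           deg := fun i => (S i).2.1
           d_homog := hf
           aug_homog := haug }, fun i => (hfr i).le.trans (hP i).2⟩

/-! ### Strictness and lifting inside `I F` -/

/-- The differentials of the resolution are strict for the `I`-adic filtration in the lowest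
degree that matters. -/
def FreeRes.IsStrict {M : Type v} [AddCommGroup M] [Module R M] (F : FreeRes R M) (I : Ideal R) :
    Prop :=
  ∀ i, I ^ 2 • (⊤ : Submodule R (F.ι i → R)) ⊓ LinearMap.range (F.d i) ≤
    (I • (⊤ : Submodule R (F.ι (i + 1) → R))).map (F.d i)

variable {M P N : Type v} [AddCommGroup M] [AddCommGroup P] [AddCommGroup N]
  [Module R M] [Module R P] [Module R N] {gM : HomogProj M} {gP : HomogProj P} {gN : HomogProj N}

/-- A map with image in `I F₀` from a minimal complex to a strict resolution extends to a chain
map with image in `I F` (up to sign). -/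
theorem exists_chain_lift {I : Ideal R} (hR : GradedLocal gR I) (F : HomogRes gR gM)
    (hF : F.IsStrict I) (C : HomogComplex gR)
    (hC : ∀ i, LinearMap.range (C.d i) ≤ I • (⊤ : Submodule R (C.κ i → R)))
    (θ₀ : (C.κ 1 → R) →ₗ[R] (F.ι 0 → R)) (hθ : Homog (free gR (C.deg 1)) (free gR (F.deg 0)) θ₀)
    (hI : LinearMap.range θ₀ ≤ I • ⊤) (h0 : F.aug ∘ₗ θ₀ ∘ₗ C.d 1 = 0) :
    ∃ θ : ∀ i, (C.κ (i + 1) → R) →ₗ[R] (F.ι i → R), θ 0 = θ₀ ∧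
      (∀ i, Homog (free gR (C.deg (i + 1))) (free gR (F.deg i)) (θ i)) ∧
      (∀ i, LinearMap.range (θ i) ≤ I • ⊤) ∧
      ∀ i, F.d i ∘ₗ θ (i + 1) = -(θ i ∘ₗ C.d (i + 1)) := by
  obtain ⟨θ, h1, h2, h3⟩ := exists_seq_of_step
    (α := fun i => (C.κ (i + 1) → R) →ₗ[R] (F.ι i → R))
    (fun i θ => Homog (free gR (C.deg (i + 1))) (free gR (F.deg i)) θ ∧
      LinearMap.range θ ≤ I • ⊤ ∧ LinearMap.range (θ ∘ₗ C.d (i + 1)) ≤ LinearMap.range (F.d i))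
    (fun i θ θ' => F.d i ∘ₗ θ' = -(θ ∘ₗ C.d (i + 1))) θ₀
    ⟨hθ, hI, by
      rintro _ ⟨x, rfl⟩
      exact (F.exact_zero _).1 (LinearMap.congr_fun h0 x)⟩
    (by
      rintro i θ ⟨hθ, hI, hr⟩
      have hle : LinearMap.range (-(θ ∘ₗ C.d (i + 1))) ≤
          (I • (⊤ : Submodule R (F.ι (i + 1) → R))).map (F.d i) := by
        rw [LinearMap.range_neg]
        -- The crux: one factor `I` comes from `θ` and one from the differential of `C`, so the
        -- image lies in `I ^ 2` and strictness allows a lift with image still in `I F`.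
        refine le_trans (le_inf ?_ hr) (hF i)
        rw [LinearMap.range_comp]
        refine (Submodule.map_mono (hC (i + 1))).trans ?_
        rw [Submodule.map_smul'', Submodule.map_top, pow_two, Submodule.mul_smul]
        exact Submodule.smul_mono le_rfl hI
      obtain ⟨θ', h1, h2, h3⟩ := exists_homog_lift hR.one (C.deg (i + 2)) (Compat.free hR.compat _)
        (hθ.comp (C.d_homog _)).neg (F.d_homog i) (stable_smul_top_free hR.stable _) hle
      refine ⟨θ', ⟨h1, h2, ?_⟩, h3⟩
      rintro _ ⟨x, rfl⟩
      refine (F.exact_succ i _).1 ?_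
      have h4 := LinearMap.congr_fun h3 (C.d (i + 2) x)
      have h5 := LinearMap.congr_fun (C.d_comp (i + 1)) x
      simp only [LinearMap.comp_apply, LinearMap.neg_apply, LinearMap.zero_apply] at h4 h5 ⊢
      rw [h4, h5, map_zero, neg_zero])
  exact ⟨θ, h1, fun i => (h2 i).1, fun i => (h2 i).2.1, h3⟩

/-! ### Twisted direct sums and shifts -/

/-- The map `(x, y) ↦ (f x + θ y, g y)`. -/
def twistMap {ι ι' κ κ' : Type} (f : (ι' → R) →ₗ[R] (ι → R)) (g : (κ' → R) →ₗ[R] (κ → R))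
    (θ : (κ' → R) →ₗ[R] (ι → R)) : (ι' ⊕ κ' → R) →ₗ[R] (ι ⊕ κ → R) where
  toFun x := Sum.elim (f (x ∘ Sum.inl) + θ (x ∘ Sum.inr)) (g (x ∘ Sum.inr))
  map_add' x y := by
    have h1 : (x + y) ∘ Sum.inl = x ∘ Sum.inl + y ∘ Sum.inl := rfl
    have h2 : (x + y) ∘ Sum.inr = x ∘ Sum.inr + y ∘ Sum.inr := rfl
    rw [h1, h2]
    ext (e | e)
    · simp only [map_add, Sum.elim_inl, Pi.add_apply]; ring
    · simp only [map_add, Sum.elim_inr, Pi.add_apply]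
  map_smul' r x := by
    have h1 : (r • x) ∘ Sum.inl = r • (x ∘ Sum.inl) := rfl
    have h2 : (r • x) ∘ Sum.inr = r • (x ∘ Sum.inr) := rfl
    rw [h1, h2]
    ext (e | e) <;> simp [mul_add]

theorem twistMap_comp_inl {ι ι' κ κ' : Type} (f : (ι' → R) →ₗ[R] (ι → R))
    (g : (κ' → R) →ₗ[R] (κ → R)) (θ : (κ' → R) →ₗ[R] (ι → R)) (x : ι' ⊕ κ' → R) :
    twistMap f g θ x ∘ Sum.inl = f (x ∘ Sum.inl) + θ (x ∘ Sum.inr) := rfl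

theorem twistMap_comp_inr {ι ι' κ κ' : Type} (f : (ι' → R) →ₗ[R] (ι → R))
    (g : (κ' → R) →ₗ[R] (κ → R)) (θ : (κ' → R) →ₗ[R] (ι → R)) (x : ι' ⊕ κ' → R) :
    twistMap f g θ x ∘ Sum.inr = g (x ∘ Sum.inr) := rfl

theorem Sum.funext_comp {ι κ A : Type*} {x y : ι ⊕ κ → A} (h1 : x ∘ Sum.inl = y ∘ Sum.inl)
    (h2 : x ∘ Sum.inr = y ∘ Sum.inr) : x = y := by
  funext e
  rcases e with e | e
  · exact congrFun h1 e
  · exact congrFun h2 e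

/-- A resolution whose modules are `F i ⊕ C i`, with differential
`(x, y) ↦ (d x + θ y, d y)`. -/
def HomogRes.twist (F : HomogRes gR gM) (C : HomogComplex gR)
    (θ : ∀ i, (C.κ (i + 1) → R) →ₗ[R] (F.ι i → R))
    (hθ : ∀ i, Homog (free gR (C.deg (i + 1))) (free gR (F.deg i)) (θ i))
    (hd : ∀ i, F.d i ∘ₗ θ (i + 1) = -(θ i ∘ₗ C.d (i + 1)))
    (hex : ∀ i x y, F.d i x + θ i y = 0 → C.d i y = 0 → ∃ z, C.d (i + 1) z = y)
    (aug : (F.ι 0 ⊕ C.κ 0 → R) →ₗ[R] N)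
    (haug : Homog (free gR (Sum.elim (F.deg 0) (C.deg 0))) gN aug)
    (h0 : Function.Exact (twistMap (F.d 0) (C.d 0) (θ 0)) aug)
    (hs : Function.Surjective aug) : HomogRes gR gN where
  ι i := F.ι i ⊕ C.κ i
  finite_index _ := inferInstance
  d i := twistMap (F.d i) (C.d i) (θ i)
  aug := aug
  exact_succ i := by
    intro x
    have hFF := fun z => (F.exact_succ i (F.d (i + 1) z)).2 ⟨z, rfl⟩
    have hCC := fun z => LinearMap.congr_fun (C.d_comp i) z
    have hFC := fun z => LinearMap.congr_fun (hd i) z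
    simp only [LinearMap.comp_apply, LinearMap.neg_apply, LinearMap.zero_apply] at hCC hFC
    constructor
    · intro hx
      have h1 : F.d i (x ∘ Sum.inl) + θ i (x ∘ Sum.inr) = 0 := congrArg (· ∘ Sum.inl) hx
      have h2 : C.d i (x ∘ Sum.inr) = 0 := congrArg (· ∘ Sum.inr) hx
      -- `hex` asks for exactness of `C` only at those cycles that extend to cycles of the sum. This
      -- weaker demand is needed for the shifted complex, whose lowest differential is zero.
      obtain ⟨y, hy⟩ := hex i _ _ h1 h2
      obtain ⟨z, hz⟩ := (F.exact_succ i (x ∘ Sum.inl - θ (i + 1) y)).1 (by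
        rw [map_sub, hFC, hy, sub_neg_eq_add, h1])
      refine ⟨Sum.elim z y, Sum.funext_comp ?_ ?_⟩
      · rw [twistMap_comp_inl, Sum.elim_comp_inl, Sum.elim_comp_inr, hz, sub_add_cancel]
      · rw [twistMap_comp_inr, Sum.elim_comp_inr, hy]
    · rintro ⟨y, rfl⟩
      refine Sum.funext_comp ?_ ?_
      · rw [twistMap_comp_inl, twistMap_comp_inl, twistMap_comp_inr, map_add, hFF, hFC]
        simp only [zero_add, neg_add_cancel]; rfl
      · rw [twistMap_comp_inr, twistMap_comp_inr, hCC]; rfl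
  exact_zero := h0
  aug_surjective := hs
  deg i := Sum.elim (F.deg i) (C.deg i)
  d_homog i j x := by
    refine Sum.funext_comp ?_ ?_
    · have h1 := F.d_homog i j (x ∘ Sum.inl)
      have h2 := hθ i j (x ∘ Sum.inr)
      exact (congrArg₂ (· + ·) h1 h2).trans (map_add _ _ _).symm
    · exact C.d_homog i j (x ∘ Sum.inr)
  aug_homog := haug

theorem HomogRes.twist_isMinimal {I : Ideal R} {F : HomogRes gR gM} {C : HomogComplex gR}
    {θ : ∀ i, (C.κ (i + 1) → R) →ₗ[R] (F.ι i → R)} {hθ hd hex}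
    {aug : (F.ι 0 ⊕ C.κ 0 → R) →ₗ[R] N} {haug : Homog _ gN aug} {h0 hs}
    (hF : F.IsMinimal I) (hC : ∀ i, LinearMap.range (C.d i) ≤ I • (⊤ : Submodule R (C.κ i → R)))
    (hI : ∀ i, LinearMap.range (θ i) ≤ I • ⊤) :
    (F.twist C θ hθ hd hex aug haug h0 hs).IsMinimal I := by
  rintro i _ ⟨x, rfl⟩
  refine mem_smul_top_pi.2 ?_
  rintro (e | e)
  · exact I.add_mem (mem_smul_top_pi.1 (hF i ⟨x ∘ Sum.inl, rfl⟩) e)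
      (mem_smul_top_pi.1 (hI i ⟨x ∘ Sum.inr, rfl⟩) e)
  · exact mem_smul_top_pi.1 (hC i ⟨x ∘ Sum.inr, rfl⟩) e

/-- The complex underlying a resolution. -/
abbrev HomogRes.toComplex (F : HomogRes gR gM) : HomogComplex gR where
  κ := F.ι
  finite_index := inferInstance
  d := F.d
  d_comp i := LinearMap.comp_eq_zero_of_exact (F.exact_succ i)
  deg := F.deg
  d_homog := F.d_homog

/-- The index sets of a resolution, shifted by one. -/
def HomogRes.shiftIndex (F : HomogRes gR gM) : ℕ → Type
  | 0 => Empty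
  | i + 1 => F.ι i

instance (F : HomogRes gR gM) : ∀ i, Finite (F.shiftIndex i)
  | 0 => inferInstanceAs (Finite Empty)
  | i + 1 => F.finite_index i

/-- The differentials of the shifted complex. -/
def HomogRes.shiftD (F : HomogRes gR gM) :
    ∀ i, (F.shiftIndex (i + 1) → R) →ₗ[R] (F.shiftIndex i → R)
  | 0 => 0
  | i + 1 => F.d i

/-- The degrees of the basis elements of the shifted complex. -/
def HomogRes.shiftDeg (F : HomogRes gR gM) : ∀ i, F.shiftIndex i → ℤ
  | 0 => fun e => nomatch e
  | i + 1 => F.deg i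

/-- The complex underlying a resolution, with homological degrees raised by one. -/
def HomogRes.shift (F : HomogRes gR gM) : HomogComplex gR where
  κ := F.shiftIndex
  finite_index := inferInstance
  d := F.shiftD
  d_comp
    | 0 => LinearMap.zero_comp _
    | i + 1 => LinearMap.comp_eq_zero_of_exact (F.exact_succ i)
  deg := F.shiftDeg
  d_homog
    | 0 => fun _ _ => (map_zero _).symm
    | i + 1 => F.d_homog i

/-! ### Minimal resolutions for the two short exact sequences -/

/-- The minimal resolution of the middle term of a pure extension is the direct sum, up to a
twist of the differential, of those of the outer terms. -/
theorem exists_homogRes_of_pure {I : Ideal R} (hR : GradedLocal gR I)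
    (hcP : Compat gR gP)
    {φ : M →ₗ[R] P} {ψ : P →ₗ[R] N} (hφ : Homog gM gP φ) (hψ : Homog gP gN ψ)
    (hinj : Function.Injective φ) (hexact : Function.Exact φ ψ) (hsurj : Function.Surjective ψ)
    (F : HomogRes gR gM) (hF : F.IsMinimal I) (hFs : F.IsStrict I)
    (H : HomogRes gR gN) (hH : H.IsMinimal I)
    (hpure : LinearMap.range φ ⊓ I • (⊤ : Submodule R P) = I • LinearMap.range φ) :
    ∃ B : HomogRes gR gP, B.IsMinimal I ∧
      ∀ i j, B.HasDeg i j ↔ F.HasDeg i j ∨ H.HasDeg i j := by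
  obtain ⟨l, hl, -, hψl⟩ := exists_homog_lift hR.one (H.deg 0) hcP H.aug_homog hψ (stable_top gP)
    (by rw [Submodule.map_top, LinearMap.range_eq_top.2 hsurj]; exact le_top)
  -- The image lies in `range φ` because `ψ` kills it, and in `I P` because `H` is minimal. Purity
  -- turns the intersection into `I • range φ`, which is the image of `I F₀`.
  have hle : LinearMap.range (-(l ∘ₗ H.d 0)) ≤
      (I • (⊤ : Submodule R (F.ι 0 → R))).map (φ ∘ₗ F.aug) := by
    rw [Submodule.map_smul'', Submodule.map_top, LinearMap.range_comp,
      LinearMap.range_eq_top.2 F.aug_surjective, Submodule.map_top, ← hpure, LinearMap.range_neg]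
    refine le_inf ?_ ?_
    · rintro _ ⟨x, rfl⟩
      refine (hexact _).1 ?_
      rw [LinearMap.comp_apply, ← LinearMap.comp_apply ψ, hψl]
      exact (H.exact_zero _).2 ⟨x, rfl⟩
    · rw [LinearMap.range_comp]
      refine (Submodule.map_mono (hH 0)).trans ?_
      rw [Submodule.map_smul'']
      exact Submodule.smul_mono le_rfl le_top
  obtain ⟨θ₀, hθ₀, hI, hφθ⟩ := exists_homog_lift hR.one (H.deg 1) (Compat.free hR.compat _)
    (hl.comp (H.d_homog 0)).neg (hφ.comp F.aug_homog) (stable_smul_top_free hR.stable _) hle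
  have hφθ' := fun x => LinearMap.congr_fun hφθ x
  simp only [LinearMap.comp_apply, LinearMap.neg_apply] at hφθ'
  have hdd : ∀ x, H.d 0 (H.d 1 x) = 0 := fun x => (H.exact_succ 0 _).2 ⟨x, rfl⟩
  obtain ⟨θ, rfl, hθ, hI, hdθ⟩ := exists_chain_lift hR F hFs H.toComplex hH θ₀ hθ₀ hI (by
    refine LinearMap.ext fun x => hinj ?_
    refine (hφθ' (H.d 1 x)).trans ?_
    rw [hdd, map_zero, neg_zero, LinearMap.zero_apply, map_zero])
  let aug : (F.ι 0 ⊕ H.ι 0 → R) →ₗ[R] P :=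
    φ ∘ₗ F.aug ∘ₗ LinearMap.funLeft R R Sum.inl + l ∘ₗ LinearMap.funLeft R R Sum.inr
  have haug : ∀ x, aug x = φ (F.aug (x ∘ Sum.inl)) + l (x ∘ Sum.inr) := fun _ => rfl
  have hψφ : ∀ x, ψ (φ x) = 0 := fun x => (hexact _).2 ⟨x, rfl⟩
  have hψl' : ∀ x, ψ (l x) = H.aug x := fun x => LinearMap.congr_fun hψl x
  refine ⟨F.twist H.toComplex θ hθ hdθ (fun i x y _ hy => (H.exact_succ i y).1 hy) aug ?_ ?_ ?_,
    HomogRes.twist_isMinimal hF hH hI, ?_⟩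
  · intro j x
    rw [haug, haug, map_add, ← hφ, ← F.aug_homog, ← hl]
    rfl
  · intro x
    rw [haug]
    constructor
    · intro hx
      have h1 := congrArg ψ hx
      rw [map_add, hψφ, zero_add, hψl', map_zero] at h1
      obtain ⟨y, hy⟩ := (H.exact_zero _).1 h1
      obtain ⟨z, hz⟩ := (F.exact_zero (x ∘ Sum.inl - θ 0 y)).1 (hinj (by
        rw [map_sub, map_sub, hφθ', hy, map_zero, sub_neg_eq_add, hx]))
      refine ⟨Sum.elim z y, Sum.funext_comp ?_ ?_⟩
      · rw [twistMap_comp_inl, Sum.elim_comp_inl, Sum.elim_comp_inr, hz, sub_add_cancel]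
      · rw [twistMap_comp_inr, Sum.elim_comp_inr]; exact hy
    · rintro ⟨y, rfl⟩
      rw [twistMap_comp_inl, twistMap_comp_inr, map_add, map_add, hφθ',
        (F.exact_zero _).2 ⟨_, rfl⟩, map_zero, zero_add]
      exact neg_add_cancel _
  · intro x
    obtain ⟨y, hy⟩ := H.aug_surjective (ψ x)
    obtain ⟨m, hm⟩ := (hexact (x - l y)).1 (by rw [map_sub, hψl', hy, sub_self])
    obtain ⟨z, rfl⟩ := F.aug_surjective m
    refine ⟨Sum.elim z y, ?_⟩
    rw [haug, Sum.elim_comp_inl, Sum.elim_comp_inr, hm, sub_add_cancel]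
  · intro i j
    exact Sum.exists

/-- The minimal resolution of the cokernel of a small inclusion into a module with strict
resolution is the mapping cone of a lift of the inclusion. -/
theorem exists_homogRes_of_small {I : Ideal R} (hR : GradedLocal gR I)
    {φ : M →ₗ[R] P} {ψ : P →ₗ[R] N} (hφ : Homog gM gP φ) (hψ : Homog gP gN ψ)
    (hinj : Function.Injective φ) (hexact : Function.Exact φ ψ) (hsurj : Function.Surjective ψ)
    (F : HomogRes gR gP) (hF : F.IsMinimal I) (hFs : F.IsStrict I)
    (G : HomogRes gR gM) (hG : G.IsMinimal I)
    (hsmall : LinearMap.range φ ≤ I • (⊤ : Submodule R P)) :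
    ∃ B : HomogRes gR gN, B.IsMinimal I ∧ (∀ j, B.HasDeg 0 j ↔ F.HasDeg 0 j) ∧
      ∀ i j, B.HasDeg (i + 1) j ↔ F.HasDeg (i + 1) j ∨ G.HasDeg i j := by
  -- Since `F.aug` is onto, `I P` is the image of `I F₀`; smallness therefore lets the inclusion
  -- lift with image in `I F₀`.
  obtain ⟨θ₀, hθ₀, hI, haugθ⟩ := exists_homog_lift hR.one (G.deg 0) (Compat.free hR.compat _)
    (hφ.comp G.aug_homog) F.aug_homog (stable_smul_top_free hR.stable (F.deg 0)) (by
      rw [Submodule.map_smul'', Submodule.map_top, LinearMap.range_eq_top.2 F.aug_surjective]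
      exact (LinearMap.range_comp_le_range _ _).trans hsmall)
  have haugθ' := fun x => LinearMap.congr_fun haugθ x
  simp only [LinearMap.comp_apply] at haugθ'
  have hC : ∀ i, LinearMap.range (G.shift.d i) ≤ I • (⊤ : Submodule R (G.shift.κ i → R))
    | 0 => by
      rintro _ ⟨x, rfl⟩
      exact Submodule.zero_mem _
    | i + 1 => hG i
  let ε : (G.shift.κ (0 + 1) → R) →ₗ[R] M := G.aug
  have hε : Function.Surjective ε := G.aug_surjective
  have hdε : Function.Exact (G.shift.d (0 + 1)) ε := G.exact_zero
  obtain ⟨θ, hθ0, hθ, hI, hdθ⟩ := exists_chain_lift hR F hFs G.shift hC θ₀ hθ₀ hI (by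
    refine LinearMap.ext fun x => ?_
    refine (haugθ' (G.d 0 x)).trans ?_
    rw [(G.exact_zero _).2 ⟨x, rfl⟩, map_zero, LinearMap.zero_apply])
  have haugε : ∀ x, F.aug (θ 0 x) = φ (ε x) := by rw [hθ0]; exact haugθ'
  let aug : (F.ι 0 ⊕ G.shift.κ 0 → R) →ₗ[R] N :=
    ψ ∘ₗ F.aug ∘ₗ LinearMap.funLeft R R Sum.inl
  have haug : ∀ x, aug x = ψ (F.aug (x ∘ Sum.inl)) := fun _ => rfl
  have hψφ : ∀ x, ψ (φ x) = 0 := fun x => (hexact _).2 ⟨x, rfl⟩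
  have hempty : IsEmpty (G.shift.κ 0) := inferInstanceAs (IsEmpty Empty)
  have hex : ∀ i x y, F.d i x + θ i y = 0 → G.shift.d i y = 0 → ∃ z, G.shift.d (i + 1) z = y
    | 0, x, y, h, _ => by
      -- In degree 0 the shifted differential gives no information; injectivity of `φ` forces `ε y =
      -- 0` instead.
      have h1 := congrArg F.aug h
      rw [map_add, (F.exact_zero _).2 ⟨_, rfl⟩, zero_add, haugε, map_zero] at h1
      exact (hdε _).1 (hinj (h1.trans (map_zero φ).symm))
    | i + 1, x, y, _, hy => (G.exact_succ i y).1 hy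
  refine ⟨F.twist G.shift θ hθ hdθ hex aug ?_ ?_ ?_,
    HomogRes.twist_isMinimal hF hC hI, ?_, ?_⟩
  · intro j x
    rw [haug, haug, ← hψ, ← F.aug_homog]
    rfl
  · intro x
    rw [haug]
    constructor
    · intro hx
      obtain ⟨m, hm⟩ := (hexact _).1 hx
      obtain ⟨y, rfl⟩ := hε m
      obtain ⟨z, hz⟩ := (F.exact_zero (x ∘ Sum.inl - θ 0 y)).1 (by
        rw [map_sub, haugε, hm, sub_self])
      refine ⟨Sum.elim z y, Sum.funext_comp ?_ (Subsingleton.elim _ _)⟩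
      rw [twistMap_comp_inl, Sum.elim_comp_inl, Sum.elim_comp_inr, hz, sub_add_cancel]
    · rintro ⟨y, rfl⟩
      rw [twistMap_comp_inl, map_add, haugε, (F.exact_zero _).2 ⟨_, rfl⟩, zero_add, hψφ]
  · intro x
    obtain ⟨y, rfl⟩ := hsurj x
    obtain ⟨z, rfl⟩ := F.aug_surjective y
    exact ⟨Sum.elim z 0, by rw [haug, Sum.elim_comp_inl]⟩
  · intro j
    refine Sum.exists.trans (or_iff_left ?_)
    rintro ⟨e, -⟩
    exact hempty.elim e
  · intro i j
    exact Sum.exists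

end

/-- The constant vector 1 would have its entries in `I`. Working with free modules, this replaces
Nakayama's lemma. -/
theorem isEmpty_of_top_le_smul_top {R : Type*} [CommRing R] {I : Ideal R} (hI : I ≠ ⊤) {ι : Type*}
    [Finite ι] (h : ∀ x : ι → R, x ∈ I • (⊤ : Submodule R (ι → R))) : IsEmpty ι := by
  classical
  refine ⟨fun e => hI ((Ideal.eq_top_iff_one I).2 ?_)⟩
  exact mem_smul_top_pi.1 (h fun _ => 1) e

/-! ### Projective dimension as the length of a minimal resolution -/

section ProjectiveDimension

variable {R : Type u} [CommRing R]

/-- The resolution of the first syzygy module. -/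
def FreeRes.syzygy {M : Type v} [AddCommGroup M] [Module R M] (F : FreeRes R M) :
    FreeRes R (LinearMap.range (F.d 0)) where
  ι i := F.ι (i + 1)
  finite_index _ := inferInstance
  d i := F.d (i + 1)
  aug := (F.d 0).rangeRestrict
  exact_succ i := F.exact_succ (i + 1)
  exact_zero x := by
    rw [← F.exact_succ 0 x, Subtype.ext_iff]
    rfl
  aug_surjective := LinearMap.surjective_rangeRestrict _

/-- A splitting `s` of the augmentation makes `1 - s ∘ aug` a projection of `F₀` onto `im d₀`.
Applied to `d₀ x ∈ I F₀`, it gives `d₀ x ∈ I • im d₀ = d₀ (I F₁)`; as `ker d₀ = im d₁ ⊆ I F₁`, this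
yields `F₁ = I F₁`, so `F₁` has empty basis. -/
theorem FreeRes.projective_iff_isEmpty {I : Ideal R} (hI : I ≠ ⊤) {M : Type v} [AddCommGroup M]
    [Module R M] (F : FreeRes R M) (hF : F.IsMinimal I) :
    Module.Projective R M ↔ IsEmpty (F.ι 1) := by
  constructor
  · intro h
    obtain ⟨s, hs⟩ := Module.projective_lifting_property F.aug LinearMap.id F.aug_surjective
    have hs' : ∀ x, F.aug (s x) = x := fun x => LinearMap.congr_fun hs x
    let e : (F.ι 0 → R) →ₗ[R] (F.ι 0 → R) := LinearMap.id - s ∘ₗ F.aug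
    have he : LinearMap.range e ≤ LinearMap.range (F.d 0) := by
      rintro _ ⟨x, rfl⟩
      refine (F.exact_zero _).1 ?_
      change F.aug (x - s (F.aug x)) = 0
      rw [map_sub, hs', sub_self]
    refine isEmpty_of_top_le_smul_top hI fun x => ?_
    have h1 : F.d 0 x ∈ (I • (⊤ : Submodule R (F.ι 0 → R))).map e := by
      refine ⟨F.d 0 x, hF 0 ⟨x, rfl⟩, ?_⟩
      change F.d 0 x - s (F.aug (F.d 0 x)) = F.d 0 x
      rw [(F.exact_zero _).2 ⟨x, rfl⟩, map_zero, sub_zero]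
    have h2 : F.d 0 x ∈ (I • (⊤ : Submodule R (F.ι 1 → R))).map (F.d 0) := by
      rw [Submodule.map_smul'', Submodule.map_top] at h1 ⊢
      exact Submodule.smul_mono le_rfl he h1
    obtain ⟨y, hy, hyx⟩ := h2
    obtain ⟨z, hz⟩ := (F.exact_succ 0 (x - y)).1 (by rw [map_sub, hyx, sub_self])
    rw [← sub_add_cancel x y, ← hz]
    exact Submodule.add_mem _ (hF 1 ⟨z, rfl⟩) hy
  · intro h
    have hinj : Function.Injective F.aug := by
      rw [injective_iff_map_eq_zero]
      intro x hx
      obtain ⟨y, rfl⟩ := (F.exact_zero x).1 hx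
      rw [Subsingleton.elim y 0, map_zero]
    exact Module.Projective.of_equiv (LinearEquiv.ofBijective F.aug ⟨hinj, F.aug_surjective⟩)

theorem FreeRes.subsingleton_iff_isEmpty {I : Ideal R} (hI : I ≠ ⊤) {M : Type v} [AddCommGroup M]
    [Module R M] (F : FreeRes R M) (hF : F.IsMinimal I) : Subsingleton M ↔ IsEmpty (F.ι 0) := by
  constructor
  · intro h
    refine isEmpty_of_top_le_smul_top hI fun x => hF 0 ?_
    exact (F.exact_zero x).1 (Subsingleton.elim _ _)
  · intro h
    exact F.aug_surjective.subsingleton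

open CategoryTheory in
/-- The projective dimension is the length of a minimal free resolution. -/
theorem FreeRes.hasProjectiveDimensionLT_iff {I : Ideal R} (hI : I ≠ ⊤) (n : ℕ) :
    ∀ {M : Type u} [AddCommGroup M] [Module R M] (F : FreeRes R M), F.IsMinimal I →
      (HasProjectiveDimensionLT (ModuleCat.of R M) n ↔ IsEmpty (F.ι n)) := by
  -- Dimension shifting along the syzygy passes from `n + 2` to `n + 1` only, so vanishing (`n = 0`)
  -- and projectivity (`n = 1`) are separate base cases.
  induction n using Nat.twoStepInduction with
  | zero =>
    intro M _ _ F hF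
    rw [hasProjectiveDimensionLT_zero_iff_isZero, ← F.subsingleton_iff_isEmpty hI hF]
    exact ModuleCat.isZero_iff_subsingleton
  | one =>
    intro M _ _ F hF
    rw [← projective_iff_hasProjectiveDimensionLT_one, ← F.projective_iff_isEmpty hI hF]
    exact (IsProjective.iff_projective (R := R) M).symm
  | more n _ ih =>
    intro M _ _ F hF
    have hS := LinearMap.shortExact_shortComplexKer F.aug_surjective
    have h1 := hS.hasProjectiveDimensionLT_X₃_iff n
      ((IsProjective.iff_projective (R := R) (F.ι 0 → R)).1 inferInstance)
    refine h1.trans ?_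
    have h2 : LinearMap.ker F.aug = LinearMap.range (F.d 0) := LinearMap.exact_iff.1 F.exact_zero
    refine Iff.trans ?_ (ih F.syzygy fun i => hF (i + 1))
    have e : ModuleCat.of R (LinearMap.ker F.aug) ≅ ModuleCat.of R (LinearMap.range (F.d 0)) :=
      (LinearEquiv.ofEq _ _ h2).toModuleIso
    exact ⟨fun _ => hasProjectiveDimensionLT_of_iso e _,
      fun _ => hasProjectiveDimensionLT_of_iso e.symm _⟩

theorem projDim_lt_iff {I : Ideal R} (hI : I ≠ ⊤) {M : Type u} [AddCommGroup M] [Module R M]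
    (F : FreeRes R M) (hF : F.IsMinimal I) (n : ℕ) : projDim R M < n ↔ IsEmpty (F.ι n) :=
  CategoryTheory.projectiveDimension_lt_iff.trans (FreeRes.hasProjectiveDimensionLT_iff hI n F hF)

end ProjectiveDimension

/-! ### From vanishing linear homology to strictness -/

section Strict

variable {R : Type u} [CommRing R] {M : Type v} [AddCommGroup M] [Module R M]

theorem mem_range_of_subsingleton_homologyOf {C : ℕ → Type*} [∀ i, AddCommGroup (C i)]
    [∀ i, Module R (C i)] (d : ∀ i, C (i + 1) →ₗ[R] C i) (i : ℕ)
    (h : Subsingleton (homologyOf d (i + 1))) (x : C (i + 1)) (hx : d i x = 0) :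
    x ∈ LinearMap.range (d (i + 1)) := by
  rw [Submodule.Quotient.subsingleton_iff] at h
  have h1 : (⟨x, hx⟩ : cyclesOf d (i + 1)) ∈ (⊤ : Submodule R _) := trivial
  rwa [← h] at h1

/-- If `d y ∈ I ^ 2 F_i`, the class of `y` in `F_{i+1} / I F_{i+1}`, the part with `n = i + 1`, is a
cycle of the linear part. It is then a boundary, so `y` agrees with some `d z` modulo `I F_{i+1}`;
minimality puts `d z`, hence `y`, in `I F_{i+1}`. -/
theorem FreeRes.isStrict_of_linHomology {I : Ideal R} (F : FreeRes R M) (hF : F.IsMinimal I)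
    (h : ∀ i, ¬ F.LinHomologyNeZero hF (i + 1)) : F.IsStrict I := by
  rintro i _ ⟨hx, y, rfl⟩
  have h0 : F.filt I (i + 1) (i + 1) = ⊤ := by
    rw [FreeRes.filt, Nat.sub_self, pow_zero, Ideal.one_eq_top, Submodule.top_smul]
  have h1 : F.filt I (i + 1 + 1) (i + 1) = I • ⊤ := by
    simp [FreeRes.filt]
  have h2 : F.filt I (i + 1 + 1) i = I ^ 2 • ⊤ := by
    rw [FreeRes.filt, show i + 1 + 1 - i = 2 by omega]
  have hn := h i
  simp only [FreeRes.LinHomologyNeZero, not_exists, not_nontrivial_iff_subsingleton] at hn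
  let y' : F.filt I (i + 1) (i + 1) := ⟨y, by rw [h0]; trivial⟩
  let q : F.linPart I (i + 1) (i + 1) := Submodule.Quotient.mk y'
  have hq : F.linPartD hF (i + 1) i q = 0 := by
    refine (Submodule.Quotient.mk_eq_zero _).2 ?_
    change F.d i y ∈ F.filt I (i + 1 + 1) i
    rw [h2]; exact hx
  obtain ⟨z, hz⟩ := mem_range_of_subsingleton_homologyOf (C := fun l => F.linPart I (i + 1) l)
    _ i (hn (i + 1)) q hq
  obtain ⟨z, rfl⟩ := Submodule.Quotient.mk_surjective _ z
  have h3 := (Submodule.Quotient.eq _).1 hz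
  change F.d (i + 1) z - y ∈ F.filt I (i + 1 + 1) (i + 1) at h3
  rw [h1] at h3
  refine ⟨y, ?_, rfl⟩
  have h4 := Submodule.sub_mem _ (hF (i + 1) ⟨z, rfl⟩) h3
  rwa [sub_sub_cancel] at h4

end Strict

/-! ### Tor with residue coefficients in terms of elements of `F` -/

section Tor

variable {R : Type u} [CommRing R] {M : Type v} [AddCommGroup M] [Module R M]

theorem mk_one_eq_zero_iff {I : Ideal R} {P : Type*} [AddCommGroup P] [Module R P] (x : P) :
    (1 : R ⧸ I) ⊗ₜ[R] x = 0 ↔ x ∈ I • (⊤ : Submodule R P) := by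
  rw [← (TensorProduct.quotTensorEquivQuotSMul P I).map_eq_zero_iff]
  have : (1 : R ⧸ I) = Ideal.Quotient.mk I 1 := rfl
  rw [this, TensorProduct.quotTensorEquivQuotSMul_mk_tmul, one_smul,
    Submodule.Quotient.mk_eq_zero]

theorem mk_one_surjective {I : Ideal R} {P : Type*} [AddCommGroup P] [Module R P]
    (t : (R ⧸ I) ⊗[R] P) : ∃ x : P, (1 : R ⧸ I) ⊗ₜ[R] x = t := by
  obtain ⟨x, hx⟩ := Submodule.Quotient.mk_surjective _ (TensorProduct.quotTensorEquivQuotSMul P I t)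
  refine ⟨x, (TensorProduct.quotTensorEquivQuotSMul P I).injective ?_⟩
  have : (1 : R ⧸ I) = Ideal.Quotient.mk I 1 := rfl
  rw [this, TensorProduct.quotTensorEquivQuotSMul_mk_tmul, one_smul, hx]

/-- The elements of `F i` whose images in `R/I ⊗ F i` are cycles. -/
def FreeRes.torCycles (F : FreeRes R M) (I : Ideal R) : ∀ i, Submodule R (F.ι i → R)
  | 0 => ⊤
  | i + 1 => (I • (⊤ : Submodule R (F.ι i → R))).comap (F.d i)

theorem FreeRes.mk_one_mem_cyclesOf (F : FreeRes R M) (I : Ideal R) : ∀ (i : ℕ) (x : F.ι i → R),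
    (1 : R ⧸ I) ⊗ₜ[R] x ∈ cyclesOf (C := fun l => (R ⧸ I) ⊗[R] (F.ι l → R))
      (fun l => F.residueD I l) i ↔ x ∈ F.torCycles I i
  | 0, x => Iff.rfl
  | i + 1, x => by
    refine Iff.trans ?_ (mk_one_eq_zero_iff (F.d i x))
    exact Iff.rfl

theorem FreeRes.mk_one_mem_range (F : FreeRes R M) (I : Ideal R) (i : ℕ) (x : F.ι i → R) :
    (1 : R ⧸ I) ⊗ₜ[R] x ∈ LinearMap.range (F.residueD I i) ↔
      ∃ y, x - F.d i y ∈ I • (⊤ : Submodule R (F.ι i → R)) := by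
  constructor
  · rintro ⟨t, ht⟩
    obtain ⟨y, rfl⟩ := mk_one_surjective t
    refine ⟨y, (mk_one_eq_zero_iff _).1 ?_⟩
    rw [TensorProduct.tmul_sub, ← ht]
    exact sub_self _
  · rintro ⟨y, hy⟩
    have := (mk_one_eq_zero_iff _).2 hy
    rw [TensorProduct.tmul_sub, sub_eq_zero] at this
    exact ⟨1 ⊗ₜ y, this.symm⟩

/-- Every element of `R/I ⊗ F i` has the form `1 ⊗ x`, so cycles and boundaries can be tested on
representatives modulo `I F i`. -/
theorem GradedFreeRes.torPiece_ne_bot_iff {k : Type w} [Field k] [Algebra k R]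
    {𝒜 : ℤ → Submodule k R} {ℳ : ℤ → AddSubgroup M} (F : GradedFreeRes 𝒜 ℳ) (i : ℕ) (j : ℤ) :
    F.torPiece i j ≠ ⊥ ↔ ∃ x ∈ freePiece 𝒜 (F.deg i) j,
      x ∈ F.torCycles (gradedMaxIdeal 𝒜) i ∧
      ¬ ∃ y, x - F.d i y ∈ gradedMaxIdeal 𝒜 • (⊤ : Submodule R (F.ι i → R)) := by
  rw [AddSubgroup.ne_bot_iff_exists_ne_zero]
  constructor
  · rintro ⟨⟨_, ⟨c, hc⟩, ⟨x, hx, hxc⟩, rfl⟩, hne⟩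
    change (1 : R ⧸ gradedMaxIdeal 𝒜) ⊗ₜ[R] x = c at hxc
    subst hxc
    refine ⟨x, hx, (F.mk_one_mem_cyclesOf _ i x).1 hc, fun h => hne (Subtype.ext ?_)⟩
    exact (Submodule.Quotient.mk_eq_zero _).2 ((F.mk_one_mem_range _ i x).2 h)
  · rintro ⟨x, hx, hc, hn⟩
    refine ⟨⟨_, ⟨⟨1 ⊗ₜ x, (F.mk_one_mem_cyclesOf _ i x).2 hc⟩, ⟨x, hx, rfl⟩, rfl⟩⟩, fun h => hn ?_⟩
    have h1 := (Submodule.Quotient.mk_eq_zero _).1 (Subtype.ext_iff.1 h)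
    exact (F.mk_one_mem_range _ i x).1 h1

end Tor

/-! ### Comparison of graded resolutions -/

section Comparison

variable {R : Type u} [CommRing R] {gR : HomogProj R} {I : Ideal R}
  {M : Type v} [AddCommGroup M] [Module R M] {gM : HomogProj M}

theorem exists_chain_map (hR : GradedLocal gR I) (F F' : HomogRes gR gM) :
    ∃ f : ∀ i, (F.ι i → R) →ₗ[R] (F'.ι i → R),
      (∀ i, Homog (free gR (F.deg i)) (free gR (F'.deg i)) (f i)) ∧
      F'.aug ∘ₗ f 0 = F.aug ∧ ∀ i, F'.d i ∘ₗ f (i + 1) = f i ∘ₗ F.d i := by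
  obtain ⟨f₀, h1, -, h2⟩ := exists_homog_lift hR.one (F.deg 0) (Compat.free hR.compat _)
    F.aug_homog F'.aug_homog (stable_top (free gR (F'.deg 0)))
    (by rw [Submodule.map_top, LinearMap.range_eq_top.2 F'.aug_surjective]; exact le_top)
  obtain ⟨f, rfl, hf, hs⟩ := exists_seq_of_step (α := fun i => (F.ι i → R) →ₗ[R] (F'.ι i → R))
    (fun i f => Homog (free gR (F.deg i)) (free gR (F'.deg i)) f ∧
      LinearMap.range (f ∘ₗ F.d i) ≤ LinearMap.range (F'.d i))
    (fun i f f' => F'.d i ∘ₗ f' = f ∘ₗ F.d i) f₀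
    ⟨h1, by
      rintro _ ⟨x, rfl⟩
      refine (F'.exact_zero _).1 ((LinearMap.congr_fun h2 (F.d 0 x)).trans ?_)
      exact (F.exact_zero _).2 ⟨x, rfl⟩⟩
    (by
      rintro i f ⟨hf, hr⟩
      obtain ⟨f', h1, -, h2⟩ := exists_homog_lift hR.one (F.deg (i + 1)) (Compat.free hR.compat _)
        (hf.comp (F.d_homog i)) (F'.d_homog i) (stable_top (free gR (F'.deg (i + 1))))
        (by rw [Submodule.map_top]; exact hr)
      refine ⟨f', ⟨h1, ?_⟩, h2⟩
      rintro _ ⟨x, rfl⟩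
      refine (F'.exact_succ i _).1 ((LinearMap.congr_fun h2 (F.d (i + 1) x)).trans ?_)
      rw [LinearMap.comp_apply, (F.exact_succ i _).2 ⟨x, rfl⟩, map_zero])
  exact ⟨f, fun i => (hf i).1, h2, hs⟩

/-- A chain map over the zero map is null-homotopic. -/
theorem exists_homotopy (hR : GradedLocal gR I) (F F' : HomogRes gR gM)
    (h : ∀ i, (F.ι i → R) →ₗ[R] (F'.ι i → R))
    (hh : ∀ i, Homog (free gR (F.deg i)) (free gR (F'.deg i)) (h i))
    (h0 : F'.aug ∘ₗ h 0 = 0) (hd : ∀ i, F'.d i ∘ₗ h (i + 1) = h i ∘ₗ F.d i) :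
    ∃ s : ∀ i, (F.ι i → R) →ₗ[R] (F'.ι (i + 1) → R), F'.d 0 ∘ₗ s 0 = h 0 ∧
      ∀ i, F'.d (i + 1) ∘ₗ s (i + 1) = h (i + 1) - s i ∘ₗ F.d i := by
  obtain ⟨s₀, h1, -, h2⟩ := exists_homog_lift hR.one (F.deg 0) (Compat.free hR.compat _)
    (hh 0) (F'.d_homog 0) (stable_top (free gR (F'.deg 1))) (by
      rw [Submodule.map_top]
      rintro _ ⟨x, rfl⟩
      exact (F'.exact_zero _).1 (LinearMap.congr_fun h0 x))
  obtain ⟨s, rfl, -, hs⟩ := exists_seq_of_step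
    (α := fun i => (F.ι i → R) →ₗ[R] (F'.ι (i + 1) → R))
    (fun i s => Homog (free gR (F.deg i)) (free gR (F'.deg (i + 1))) s ∧
      F'.d i ∘ₗ s ∘ₗ F.d i = h i ∘ₗ F.d i)
    (fun i s s' => F'.d (i + 1) ∘ₗ s' = h (i + 1) - s ∘ₗ F.d i) s₀
    ⟨h1, by rw [← LinearMap.comp_assoc, h2]⟩
    (by
      rintro i s ⟨hs, he⟩
      obtain ⟨s', h1, -, h2⟩ := exists_homog_lift hR.one (F.deg (i + 1)) (Compat.free hR.compat _)
        ((hh (i + 1)).add (hs.comp (F.d_homog i)).neg) (F'.d_homog (i + 1))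
        (stable_top (free gR (F'.deg (i + 2)))) (by
          rw [Submodule.map_top]
          rintro _ ⟨x, rfl⟩
          refine (F'.exact_succ i _).1 ?_
          have h3 := LinearMap.congr_fun he x
          have h4 := LinearMap.congr_fun (hd i) x
          simp only [LinearMap.comp_apply, LinearMap.add_apply, LinearMap.neg_apply, map_add,
            map_neg] at h3 h4 ⊢
          rw [h3, h4, add_neg_cancel])
      refine ⟨s', ⟨h1, ?_⟩, by rw [h2, sub_eq_add_neg]⟩
      rw [← LinearMap.comp_assoc, h2, LinearMap.add_comp, LinearMap.neg_comp, LinearMap.comp_assoc,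
        LinearMap.comp_eq_zero_of_exact (F.exact_succ i), LinearMap.comp_zero, neg_zero, add_zero])
  exact ⟨s, h2, hs⟩

theorem map_mem_smul_top {P Q : Type*} [AddCommGroup P] [AddCommGroup Q] [Module R P] [Module R Q]
    (f : P →ₗ[R] Q) {x : P} (hx : x ∈ I • (⊤ : Submodule R P)) :
    f x ∈ I • (⊤ : Submodule R Q) := by
  have := Submodule.mem_map_of_mem (f := f) hx
  rw [Submodule.map_smul''] at this
  exact Submodule.smul_mono le_rfl le_top this

/-- A non-zero element of `Tor_i (R/I, M)_j`, computed from an arbitrary graded free resolution,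
forces the minimal one to have a basis element of degree `j` in homological degree `i`. -/
theorem HomogRes.hasDeg_of_torCycles (hR : GradedLocal gR I) (F F' : HomogRes gR gM) {i : ℕ}
    {j : ℤ} {z : F'.ι i → R} (hz : (free gR (F'.deg i)).p j z = z) (hc : z ∈ F'.torCycles I i)
    (hn : ¬ ∃ y, z - F'.d i y ∈ I • (⊤ : Submodule R (F'.ι i → R))) : F.HasDeg i j := by
  obtain ⟨f, hf, hf0, hfd⟩ := exists_chain_map hR F' F
  obtain ⟨g, hg, hg0, hgd⟩ := exists_chain_map hR F F'
  obtain ⟨s, hs0, hs⟩ := exists_homotopy hR F' F' (fun i => LinearMap.id + -(g i ∘ₗ f i))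
    (fun i => Homog.add (fun _ _ => rfl) ((hg i).comp (hf i)).neg)
    (by
      rw [LinearMap.comp_add, LinearMap.comp_neg, ← LinearMap.comp_assoc, hg0, hf0,
        LinearMap.comp_id, add_neg_cancel])
    (fun i => by
      rw [LinearMap.comp_add, LinearMap.comp_neg, ← LinearMap.comp_assoc, hgd, LinearMap.comp_assoc,
        hfd, LinearMap.add_comp, LinearMap.neg_comp, LinearMap.comp_id, LinearMap.id_comp,
        LinearMap.comp_assoc])
  by_contra hne
  apply hn
  -- With no basis element of degree `j`, each coordinate of `f i z` is homogeneous of non-zero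
  -- degree, hence in `I`. The homotopy `1 - g f = d s + s d` then makes `z` a boundary modulo `I`.
  have hfz : f i z ∈ I • (⊤ : Submodule R (F.ι i → R)) := by
    refine mem_smul_top_pi.2 fun e => ?_
    have h1 : gR.p (j - F.deg i e) (f i z e) = f i z e := by
      rw [← free_p_apply, ← hf, hz]
    rw [← h1]
    exact hR.mem _ (fun h => hne ⟨e, (sub_eq_zero.1 h).symm⟩) _
  refine ⟨s i z, ?_⟩
  have hgf := map_mem_smul_top (g i) hfz
  cases i with
  | zero =>
    have h2 := LinearMap.congr_fun hs0 z
    simp only [LinearMap.comp_apply, LinearMap.add_apply, LinearMap.neg_apply,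
      LinearMap.id_apply] at h2
    rw [h2]
    simpa using hgf
  | succ i =>
    have h2 := LinearMap.congr_fun (hs i) z
    simp only [LinearMap.comp_apply, LinearMap.add_apply, LinearMap.neg_apply, LinearMap.sub_apply,
      LinearMap.id_apply] at h2
    rw [h2, show z - (z + -g (i + 1) (f (i + 1) z) - s i (F'.d i z)) =
      g (i + 1) (f (i + 1) z) + s i (F'.d i z) by abel]
    exact Submodule.add_mem _ hgf (map_mem_smul_top (s i) hc)

theorem FreeRes.IsMinimal.torCycles_eq_top {F : FreeRes R M} (hF : F.IsMinimal I) :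
    ∀ i, F.torCycles I i = ⊤
  | 0 => rfl
  | i + 1 => eq_top_iff.2 fun x _ => hF i ⟨x, rfl⟩

/-- A basis vector works: by minimality it is a cycle modulo `I`, and all boundaries lie in `I F`,
which does not contain it. -/
theorem HomogRes.exists_torCycle_of_hasDeg (hR : GradedLocal gR I) (F : HomogRes gR gM)
    (hF : F.IsMinimal I) {i : ℕ} {j : ℤ} (h : F.HasDeg i j) :
    ∃ z, (free gR (F.deg i)).p j z = z ∧ z ∈ F.torCycles I i ∧
      ¬ ∃ y, z - F.d i y ∈ I • (⊤ : Submodule R (F.ι i → R)) := by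
  classical
  obtain ⟨e, rfl⟩ := h
  refine ⟨Pi.single e 1, free_single hR.one _ _, ?_, ?_⟩
  · rw [hF.torCycles_eq_top]; trivial
  · rintro ⟨y, hy⟩
    have h1 := Submodule.add_mem _ hy (hF i ⟨y, rfl⟩)
    rw [sub_add_cancel, mem_smul_top_pi] at h1
    have h2 := h1 e
    rw [Pi.single_eq_same] at h2
    exact hR.ne_top ((Ideal.eq_top_iff_one I).2 h2)

end Comparison

/-! ### Projections from internal direct sum decompositions -/

section Decomposition

open DirectSum

/-- The projections onto the components of a decomposition. -/
def HomogProj.ofDecomposition {M σ : Type*} [AddCommGroup M] [SetLike σ M] [AddSubmonoidClass σ M]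
    (ℳ : ℤ → σ) [Decomposition ℳ] : HomogProj M where
  p j := { toFun := fun x => (decompose ℳ x j : M)
           map_zero' := by simp
           map_add' := by simp }
  orth i j x := by
    simp only [AddMonoidHom.coe_mk, ZeroHom.coe_mk]
    split_ifs with h
    · subst h; rw [decompose_of_mem_same ℳ (SetLike.coe_mem _)]
    · exact decompose_of_mem_ne ℳ (SetLike.coe_mem _) (Ne.symm h)
  exists_sum x := by
    classical
    exact ⟨_, sum_support_decompose ℳ x⟩

theorem HomogProj.ofDecomposition_p_eq_iff {M σ : Type*} [AddCommGroup M] [SetLike σ M]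
    [AddSubmonoidClass σ M] (ℳ : ℤ → σ) [Decomposition ℳ] {j : ℤ} {x : M} :
    (ofDecomposition ℳ).p j x = x ↔ x ∈ ℳ j := by
  constructor
  · intro h
    rw [← h]
    exact SetLike.coe_mem _
  · exact decompose_of_mem_same ℳ

theorem HomogProj.homog_ofDecomposition {R σ τ M N : Type*} [CommRing R] [AddCommGroup M]
    [Module R M] [AddCommGroup N] [Module R N] [SetLike σ M] [AddSubmonoidClass σ M] [SetLike τ N]
    [AddSubmonoidClass τ N] {ℳ : ℤ → σ} [Decomposition ℳ] {𝒩 : ℤ → τ} [Decomposition 𝒩]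
    {f : M →ₗ[R] N} (h : ∀ j, ∀ x ∈ ℳ j, f x ∈ 𝒩 j) :
    Homog (ofDecomposition ℳ) (ofDecomposition 𝒩) f :=
  homog_of_forall fun j x hx =>
    (ofDecomposition_p_eq_iff 𝒩).2 (h j x ((ofDecomposition_p_eq_iff ℳ).1 hx))

theorem HomogProj.compat_ofDecomposition {R σ τ M : Type*} [CommRing R] [AddCommGroup M]
    [Module R M] [SetLike σ R] [AddSubmonoidClass σ R] [SetLike τ M] [AddSubmonoidClass τ M]
    (𝒜 : ℤ → σ) [Decomposition 𝒜] (ℳ : ℤ → τ) [Decomposition ℳ] [SetLike.GradedSMul 𝒜 ℳ] :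
    Compat (ofDecomposition 𝒜) (ofDecomposition ℳ) := by
  intro i j r x hx
  have hx' := (ofDecomposition_p_eq_iff ℳ).1 hx
  have hmem : ∀ l, (ofDecomposition ℳ).p (l + j) ((ofDecomposition 𝒜).p l r • x) =
      (ofDecomposition 𝒜).p l r • x := fun l =>
    (ofDecomposition_p_eq_iff ℳ).2
      (SetLike.GradedSMul.smul_mem ((ofDecomposition_p_eq_iff 𝒜).1 (p_p _ l r)) hx')
  obtain ⟨s, hs⟩ := (ofDecomposition 𝒜).exists_superset_sum r
  have h1 := hs (insert i s) (Finset.subset_insert _ _)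
  conv_lhs => rw [← h1, Finset.sum_smul, map_sum]
  rw [Finset.sum_eq_single i]
  · exact hmem i
  · intro l _ hl
    exact p_eq_zero _ (fun h => hl (add_right_cancel h).symm) (hmem l)
  · intro h; simp at h

end Decomposition

/-! ### Local rings, graded in degree 0 -/

section Local

/-- The grading concentrated in degree `0`. -/
def HomogProj.trivial (M : Type*) [AddCommGroup M] : HomogProj M where
  p j := if j = 0 then AddMonoidHom.id M else 0
  orth i j x := by
    by_cases hi : i = 0 <;> by_cases hj : j = 0 <;> simp [hi, hj, eq_comm]
  exists_sum x := ⟨{0}, by simp⟩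

theorem HomogProj.compat_trivial (R M : Type*) [CommRing R] [AddCommGroup M] [Module R M] :
    Compat (trivial R) (trivial M) := by
  intro i j r x hx
  by_cases hj : j = 0
  · subst hj
    by_cases hi : i = 0 <;> simp [trivial, hi]
  · have : x = 0 := by rw [← hx]; simp [trivial, hj]
    simp [this]

theorem HomogProj.homog_trivial {R M N : Type*} [CommRing R] [AddCommGroup M] [Module R M]
    [AddCommGroup N] [Module R N] (f : M →ₗ[R] N) : Homog (trivial M) (trivial N) f := by
  intro j x
  by_cases hj : j = 0 <;> simp [trivial, hj]

theorem gradedLocal_maximalIdeal (R : Type u) [CommRing R] [IsLocalRing R] :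
    GradedLocal (HomogProj.trivial R) (IsLocalRing.maximalIdeal R) where
  compat := compat_trivial R R
  one := by simp [HomogProj.trivial]
  ne_top := Ideal.IsPrime.ne_top'
  stable j x hx := by
    by_cases hj : j = 0
    · simpa [HomogProj.trivial, hj] using hx
    · simp [HomogProj.trivial, hj]
  isUnit r := by
    by_cases h : IsUnit r
    · right; simpa [HomogProj.trivial] using h
    · left; simpa [HomogProj.trivial] using h
  mem i hi r := by simp [HomogProj.trivial, hi]

/-- The linearity defect is a supremum over all minimal resolutions, so its vanishing applies to any
chosen one. -/
theorem IsKoszulModule.isStrict {R : Type u} [CommRing R] [IsLocalRing R] {M : Type v}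
    [AddCommGroup M] [Module R M] (h : IsKoszulModule R M) (F : FreeRes R M)
    (hF : F.IsMinimal (IsLocalRing.maximalIdeal R)) : F.IsStrict (IsLocalRing.maximalIdeal R) := by
  refine F.isStrict_of_linHomology hF fun i hi => ?_
  have h1 : ((i + 1 : ℕ) : ℕ∞) ≤ linDefect R M := le_sSup ⟨F, hF, i + 1, hi, rfl⟩
  have h2 : linDefect R M = 0 := h
  rw [h2] at h1
  simp at h1

end Local

/-! ### Standard graded algebras and regularity -/

section StandardGraded

variable {k : Type w} [Field k] {R : Type u} [CommRing R] [Algebra k R]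
  {𝒜 : ℤ → Submodule k R} [GradedAlgebra 𝒜]

/-- There are no components of negative degree. Thus the degree 0 part of `r * y` is the product of
the degree 0 parts, and the kernel of the degree 0 projection is an ideal. -/
theorem gradedMaxIdeal_mem_iff (h : IsStandardGraded 𝒜) (x : R) :
    x ∈ gradedMaxIdeal 𝒜 ↔ (ofDecomposition 𝒜).p 0 x = 0 := by
  have hneg : ∀ i < 0, ∀ y, (ofDecomposition 𝒜).p i y = 0 := by
    intro i hi y
    have h1 := (ofDecomposition_p_eq_iff 𝒜).1 ((ofDecomposition 𝒜).p_p i y)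
    rw [h.neg i hi] at h1
    exact h1
  constructor
  · intro hx
    induction hx using Submodule.span_induction with
    | mem y hy =>
      obtain ⟨i, hi, hy⟩ := hy
      exact p_eq_zero _ hi.ne ((ofDecomposition_p_eq_iff 𝒜).2 hy)
    | zero => exact map_zero _
    | add y z _ _ hy hz => rw [map_add, hy, hz, add_zero]
    | smul r y _ hy =>
      obtain ⟨s, hs⟩ := (ofDecomposition 𝒜).exists_sum y
      rw [← hs, Finset.smul_sum, map_sum]
      refine Finset.sum_eq_zero fun j _ => ?_
      have h1 := compat_ofDecomposition 𝒜 𝒜 (-j) j r _ ((ofDecomposition 𝒜).p_p j y)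
      rw [neg_add_cancel] at h1
      rw [h1]
      rcases lt_trichotomy j 0 with hj | rfl | hj
      · rw [hneg j hj, smul_zero]
      · rw [hy, smul_zero]
      · rw [hneg (-j) (by omega), zero_smul]
  · intro hx
    refine mem_of_p_mem (gM := ofDecomposition 𝒜) fun j => ?_
    rcases lt_trichotomy j 0 with hj | rfl | hj
    · rw [hneg j hj]; exact Submodule.zero_mem _
    · rw [hx]; exact Submodule.zero_mem _
    · exact Ideal.subset_span ⟨j, hj, (ofDecomposition_p_eq_iff 𝒜).1 ((ofDecomposition 𝒜).p_p j x)⟩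

theorem IsStandardGraded.gradedLocal (h : IsStandardGraded 𝒜) :
    GradedLocal (ofDecomposition 𝒜) (gradedMaxIdeal 𝒜) where
  compat := compat_ofDecomposition 𝒜 𝒜
  one := (ofDecomposition_p_eq_iff 𝒜).2 SetLike.GradedOne.one_mem
  ne_top := by
    have := h.nontrivial
    rw [Ne, Ideal.eq_top_iff_one, gradedMaxIdeal_mem_iff h,
      (ofDecomposition_p_eq_iff 𝒜).2 SetLike.GradedOne.one_mem]
    exact one_ne_zero
  stable j x hx := by
    rw [gradedMaxIdeal_mem_iff h] at hx ⊢
    rw [orth]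
    split_ifs with hj
    · rw [← hj, hx]
    · rfl
  isUnit r := by
    have h1 := (ofDecomposition_p_eq_iff 𝒜).1 ((ofDecomposition 𝒜).p_p 0 r)
    rw [h.zero] at h1
    obtain ⟨c, hc⟩ := h1
    rw [← hc]
    by_cases h0 : c = 0
    · left; rw [h0, map_zero]; exact Submodule.zero_mem _
    · right; exact (IsUnit.mk0 c h0).map (algebraMap k R)
  mem i hi r := by
    rw [gradedMaxIdeal_mem_iff h, orth, if_neg hi.symm]

theorem IsStandardGraded.isNoetherianRing (h : IsStandardGraded 𝒜) : IsNoetherianRing R := by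
  have := h.finite_one
  obtain ⟨S, hS⟩ := (Module.Finite.iff_fg (N := 𝒜 1)).1 h.finite_one
  have : Algebra.FiniteType k R := by
    refine ⟨⟨S, ?_⟩⟩
    rw [← Algebra.adjoin_span, hS, h.adjoin_one]
  exact Algebra.FiniteType.isNoetherianRing k R

theorem mem_freePiece_iff {ι : Type} [Finite ι] (a : ι → ℤ) (j : ℤ) (x : ι → R) :
    x ∈ freePiece 𝒜 a j ↔ (free (ofDecomposition 𝒜) a).p j x = x := by
  rw [funext_iff]
  exact forall_congr' fun e => (ofDecomposition_p_eq_iff 𝒜).symm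

variable {M : Type v} [AddCommGroup M] [Module R M] {ℳ : ℤ → AddSubgroup M}
  [DirectSum.Decomposition ℳ]

/-- A graded free resolution, with gradings given by projections. -/
def GradedFreeRes.toHomogRes (F : GradedFreeRes 𝒜 ℳ) :
    HomogRes (ofDecomposition 𝒜) (ofDecomposition ℳ) where
  toFreeRes := F.toFreeRes
  deg := F.deg
  d_homog i := homog_of_forall fun j x hx =>
    (mem_freePiece_iff _ _ _).1 (F.d_mem i j x ((mem_freePiece_iff _ _ _).2 hx))
  aug_homog := homog_of_forall fun j x hx =>
    (ofDecomposition_p_eq_iff ℳ).2 (F.aug_mem j x ((mem_freePiece_iff _ _ _).2 hx))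

/-- A graded free resolution, with gradings given by components. -/
def HomogRes.toGradedFreeRes (F : HomogRes (ofDecomposition 𝒜) (ofDecomposition ℳ)) :
    GradedFreeRes 𝒜 ℳ where
  toFreeRes := F.toFreeRes
  deg := F.deg
  d_mem i j x hx := by
    rw [mem_freePiece_iff] at hx ⊢
    rw [← F.d_homog, hx]
  aug_mem j x hx := by
    rw [mem_freePiece_iff] at hx
    rw [← ofDecomposition_p_eq_iff ℳ, ← F.aug_homog, hx]

theorem IsGradedKoszulModule.isStrict (h : IsGradedKoszulModule 𝒜 ℳ)
    (F : HomogRes (ofDecomposition 𝒜) (ofDecomposition ℳ))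
    (hF : F.IsMinimal (gradedMaxIdeal 𝒜)) : F.IsStrict (gradedMaxIdeal 𝒜) := by
  refine F.isStrict_of_linHomology hF fun i hi => ?_
  have h1 : ((i + 1 : ℕ) : ℕ∞) ≤ gradedLinDefect 𝒜 ℳ :=
    le_sSup ⟨F.toGradedFreeRes, hF, i + 1, hi, rfl⟩
  have h2 : gradedLinDefect 𝒜 ℳ = 0 := h
  rw [h2] at h1
  simp at h1

/-- The regularity is read off from the degrees of a minimal graded free resolution. -/
theorem regularity_eq (h : IsStandardGraded 𝒜)
    (F : HomogRes (ofDecomposition 𝒜) (ofDecomposition ℳ))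
    (hF : F.IsMinimal (gradedMaxIdeal 𝒜)) : regularity 𝒜 ℳ =
      sSup {r | ∃ (i : ℕ) (j : ℤ), F.HasDeg i j ∧ r = (((j - (i : ℤ) : ℤ) : ℝ) : EReal)} := by
  unfold regularity
  congr 1
  ext r
  constructor
  · rintro ⟨F', i, j, hne, rfl⟩
    -- The resolution `F'` need not be minimal, so the class has to be carried over to `F`.
    obtain ⟨z, hz, hc, hn⟩ := (F'.torPiece_ne_bot_iff i j).1 hne
    exact ⟨i, j, F.hasDeg_of_torCycles h.gradedLocal F'.toHomogRes
      ((mem_freePiece_iff _ _ _).1 hz) hc hn, rfl⟩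
  · rintro ⟨i, j, hd, rfl⟩
    obtain ⟨z, hz, hc, hn⟩ := F.exists_torCycle_of_hasDeg h.gradedLocal hF hd
    exact ⟨F.toGradedFreeRes, i, j, (F.toGradedFreeRes.torPiece_ne_bot_iff i j).2
      ⟨z, (mem_freePiece_iff _ _ _).2 hz, hc, hn⟩, rfl⟩

end StandardGraded

/-! ### Comparing invariants through the bases -/

section Invariants

/-- Natural numbers separate the points: only `⊥` lies below 0, and only `⊤` lies below none.
Infinite projective dimension thus needs no special treatment. -/
theorem WithBot.eq_of_forall_lt_natCast_iff {a b : WithBot ℕ∞} (h : ∀ n : ℕ, a < n ↔ b < n) :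
    a = b := by
  have key : ∀ {a b : WithBot ℕ∞}, (∀ n : ℕ, b < n → a < n) → a ≤ b := by
    intro a b h
    by_contra! hlt
    induction b with
    | bot =>
      have := h 0 (WithBot.bot_lt_coe _)
      induction a with
      | bot => exact lt_irrefl _ hlt
      | coe a => exact not_lt_bot (WithBot.coe_lt_coe.1 this)
    | coe b =>
      induction b with
      | top => exact not_top_lt hlt
      | coe b =>
        have h1 := h (b + 1) (WithBot.coe_lt_coe.2 (by exact_mod_cast Nat.lt_succ_self b))
        have h2 := (ENat.WithBot.lt_add_one_iff (n := a) (m := b)).1 (by exact_mod_cast h1)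
        exact absurd hlt (not_lt.2 h2)
  exact le_antisymm (key fun n => (h n).2) (key fun n => (h n).1)

theorem WithBot.add_one_lt_natCast_succ_iff {a : WithBot ℕ∞} {n : ℕ} :
    a + 1 < ((n + 1 : ℕ) : WithBot ℕ∞) ↔ a < n := by
  induction a with
  | bot => simp
  | coe a =>
    induction a with
    | top => simpa using add_le_add le_top le_rfl
    | coe a => norm_cast; omega

variable {R : Type u} [CommRing R] {gR : HomogProj R} {I : Ideal R} {M P N : Type u}
  [AddCommGroup M] [AddCommGroup P] [AddCommGroup N]
  [Module R M] [Module R P] [Module R N] {gM : HomogProj M} {gP : HomogProj P} {gN : HomogProj N}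

theorem HomogRes.projDim_lt_iff (hI : I ≠ ⊤) (F : HomogRes gR gM) (hF : F.IsMinimal I) (n : ℕ) :
    projDim R M < n ↔ ∀ j, ¬ F.HasDeg n j := by
  rw [_root_.projDim_lt_iff hI F.toFreeRes hF]
  exact ⟨fun h j ⟨e, _⟩ => h.elim e, fun h => ⟨fun e => h _ ⟨e, rfl⟩⟩⟩

theorem projDim_eq_max_of_hasDeg (hI : I ≠ ⊤) {F : HomogRes gR gM} (hF : F.IsMinimal I)
    {H : HomogRes gR gN} (hH : H.IsMinimal I) {B : HomogRes gR gP} (hB : B.IsMinimal I)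
    (h : ∀ i j, B.HasDeg i j ↔ F.HasDeg i j ∨ H.HasDeg i j) :
    projDim R P = max (projDim R M) (projDim R N) := by
  refine WithBot.eq_of_forall_lt_natCast_iff fun n => ?_
  rw [max_lt_iff, B.projDim_lt_iff hI hB, F.projDim_lt_iff hI hF, H.projDim_lt_iff hI hH]
  simp only [h, not_or, forall_and]

theorem projDim_eq_max_add_one_of_hasDeg (hI : I ≠ ⊤) [Nontrivial M] {F : HomogRes gR gP}
    (hF : F.IsMinimal I) {G : HomogRes gR gM} (hG : G.IsMinimal I) {B : HomogRes gR gN}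
    (hB : B.IsMinimal I) [Nontrivial P] (h0 : ∀ j, B.HasDeg 0 j ↔ F.HasDeg 0 j)
    (h : ∀ i j, B.HasDeg (i + 1) j ↔ F.HasDeg (i + 1) j ∨ G.HasDeg i j) :
    projDim R N = max (projDim R M + 1) (projDim R P) := by
  refine WithBot.eq_of_forall_lt_natCast_iff fun n => ?_
  rw [max_lt_iff]
  cases n with
  | zero =>
    -- The shift by one says nothing at `n = 0`; there `P` being non-zero makes both sides fail,
    -- since `B` and `F` have the same degree 0 basis.
    have h1 : ¬ projDim R P < (0 : ℕ) := by
      rw [CategoryTheory.projectiveDimension_lt_iff,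
        F.hasProjectiveDimensionLT_iff hI 0 hF, ← F.subsingleton_iff_isEmpty hI hF]
      exact not_subsingleton P
    have h2 : ¬ projDim R N < (0 : ℕ) := by
      rw [B.projDim_lt_iff hI hB]
      rw [F.projDim_lt_iff hI hF] at h1
      simpa only [h0] using h1
    exact ⟨fun h => absurd h h2, fun h => absurd h.2 h1⟩
  | succ n =>
    rw [WithBot.add_one_lt_natCast_succ_iff, B.projDim_lt_iff hI hB, F.projDim_lt_iff hI hF,
      G.projDim_lt_iff hI hG]
    simp only [h, not_or, forall_and]
    exact and_comm

variable {k : Type w} [Field k] [Algebra k R] {𝒜 : ℤ → Submodule k R} [GradedAlgebra 𝒜]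
  {ℳ : ℤ → AddSubgroup M} {𝒬 : ℤ → AddSubgroup P} {𝒩 : ℤ → AddSubgroup N}
  [DirectSum.Decomposition ℳ] [DirectSum.Decomposition 𝒬] [DirectSum.Decomposition 𝒩]

theorem regularity_eq_max_of_hasDeg (hA : IsStandardGraded 𝒜)
    {F : HomogRes (ofDecomposition 𝒜) (ofDecomposition ℳ)} (hF : F.IsMinimal (gradedMaxIdeal 𝒜))
    {H : HomogRes (ofDecomposition 𝒜) (ofDecomposition 𝒩)} (hH : H.IsMinimal (gradedMaxIdeal 𝒜))
    {B : HomogRes (ofDecomposition 𝒜) (ofDecomposition 𝒬)} (hB : B.IsMinimal (gradedMaxIdeal 𝒜))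
    (h : ∀ i j, B.HasDeg i j ↔ F.HasDeg i j ∨ H.HasDeg i j) :
    regularity 𝒜 𝒬 = max (regularity 𝒜 ℳ) (regularity 𝒜 𝒩) := by
  rw [regularity_eq hA B hB, regularity_eq hA F hF, regularity_eq hA H hH]
  refine Eq.trans ?_ sSup_union
  congr 1
  ext r
  simp only [h, or_and_right, exists_or]
  rfl

theorem EReal.intCast_sub_one (j : ℤ) : (((j - 1 : ℤ) : ℝ) : EReal) = ((j : ℝ) : EReal) - 1 := by
  push_cast
  rfl

theorem regularity_eq_max_sub_one_of_hasDeg (hA : IsStandardGraded 𝒜)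
    {F : HomogRes (ofDecomposition 𝒜) (ofDecomposition 𝒬)} (hF : F.IsMinimal (gradedMaxIdeal 𝒜))
    {G : HomogRes (ofDecomposition 𝒜) (ofDecomposition ℳ)} (hG : G.IsMinimal (gradedMaxIdeal 𝒜))
    {B : HomogRes (ofDecomposition 𝒜) (ofDecomposition 𝒩)} (hB : B.IsMinimal (gradedMaxIdeal 𝒜))
    (h0 : ∀ j, B.HasDeg 0 j ↔ F.HasDeg 0 j)
    (h : ∀ i j, B.HasDeg (i + 1) j ↔ F.HasDeg (i + 1) j ∨ G.HasDeg i j) :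
    regularity 𝒜 𝒩 = max (regularity 𝒜 ℳ - 1) (regularity 𝒜 𝒬) := by
  rw [regularity_eq hA B hB, regularity_eq hA F hF, regularity_eq hA G hG]
  have hshift : ∀ (i : ℕ) (j : ℤ), (((j - ((i + 1 : ℕ) : ℤ) : ℤ) : ℝ) : EReal) =
      (((j - (i : ℤ) : ℤ) : ℝ) : EReal) - 1 := by
    intro i j
    rw [← EReal.intCast_sub_one, show j - ((i + 1 : ℕ) : ℤ) = j - (i : ℤ) - 1 by push_cast; ring]
  have hone : (1 : EReal) ≠ ⊥ ∧ (1 : EReal) ≠ ⊤ := ⟨EReal.coe_ne_bot 1, EReal.coe_ne_top 1⟩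
  apply le_antisymm
  · refine sSup_le ?_
    rintro _ ⟨i, j, hd, rfl⟩
    cases i with
    | zero => exact le_max_of_le_right (le_sSup ⟨0, j, (h0 j).1 hd, rfl⟩)
    | succ i =>
      rcases (h i j).1 hd with hd | hd
      · exact le_max_of_le_right (le_sSup ⟨i + 1, j, hd, rfl⟩)
      · refine le_max_of_le_left ?_
        rw [hshift]
        exact EReal.sub_le_sub (le_sSup ⟨i, j, hd, rfl⟩) le_rfl
  · refine max_le ?_ (sSup_le ?_)
    -- Since 1 is finite, it can be moved across the inequality, so the supremum for `M` is bounded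
    -- termwise even when infinite.
    · rw [EReal.sub_le_iff_le_add (.inl hone.1) (.inl hone.2)]
      refine sSup_le ?_
      rintro _ ⟨i, j, hd, rfl⟩
      rw [← EReal.sub_le_iff_le_add (.inl hone.1) (.inl hone.2), ← hshift]
      exact le_sSup ⟨i + 1, j, (h i j).2 (Or.inr hd), rfl⟩
    · rintro _ ⟨i, j, hd, rfl⟩
      refine le_sSup ⟨i, j, ?_, rfl⟩
      cases i with
      | zero => exact (h0 j).2 hd
      | succ i => exact (h i j).2 (Or.inl hd)

end Invariants

theorem corollary3p6 :
    -- pure extensions, over a noetherian local ring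
    (∀ (R : Type u) [CommRing R] [IsLocalRing R] [IsNoetherianRing R]
        (M P N : Type u) [AddCommGroup M] [AddCommGroup P] [AddCommGroup N]
        [Module R M] [Module R P] [Module R N]
        [Module.Finite R M] [Module.Finite R P] [Module.Finite R N]
        [Nontrivial M] [Nontrivial P] [Nontrivial N]
        (φ : M →ₗ[R] P) (ψ : P →ₗ[R] N),
        Function.Injective φ → Function.Exact φ ψ → Function.Surjective ψ →
        IsKoszulModule R M →
        LinearMap.range φ ⊓ IsLocalRing.maximalIdeal R • (⊤ : Submodule R P) =
          IsLocalRing.maximalIdeal R • LinearMap.range φ →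
        projDim R P = max (projDim R M) (projDim R N)) ∧
    -- pure extensions, over a standard graded algebra
    (∀ (k : Type w) [Field k] (R : Type u) [CommRing R] [Algebra k R]
        (𝒜 : ℤ → Submodule k R) [GradedAlgebra 𝒜]
        (M P N : Type u) [AddCommGroup M] [AddCommGroup P] [AddCommGroup N]
        [Module R M] [Module R P] [Module R N]
        [Module.Finite R M] [Module.Finite R P] [Module.Finite R N]
        [Nontrivial M] [Nontrivial P] [Nontrivial N]
        (gM : ℤ → AddSubgroup M) [DirectSum.Decomposition gM] [SetLike.GradedSMul 𝒜 gM]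
        (gP : ℤ → AddSubgroup P) [DirectSum.Decomposition gP] [SetLike.GradedSMul 𝒜 gP]
        (gN : ℤ → AddSubgroup N) [DirectSum.Decomposition gN] [SetLike.GradedSMul 𝒜 gN]
        (φ : M →ₗ[R] P) (ψ : P →ₗ[R] N),
        IsStandardGraded 𝒜 →
        (∀ j, ∀ x ∈ gM j, φ x ∈ gP j) → (∀ j, ∀ x ∈ gP j, ψ x ∈ gN j) →
        Function.Injective φ → Function.Exact φ ψ → Function.Surjective ψ →
        IsGradedKoszulModule 𝒜 gM →
        LinearMap.range φ ⊓ gradedMaxIdeal 𝒜 • (⊤ : Submodule R P) =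
          gradedMaxIdeal 𝒜 • LinearMap.range φ →
        projDim R P = max (projDim R M) (projDim R N) ∧
        regularity 𝒜 gP = max (regularity 𝒜 gM) (regularity 𝒜 gN)) ∧
    -- small inclusions, over a noetherian local ring
    (∀ (R : Type u) [CommRing R] [IsLocalRing R] [IsNoetherianRing R]
        (M P N : Type u) [AddCommGroup M] [AddCommGroup P] [AddCommGroup N]
        [Module R M] [Module R P] [Module R N]
        [Module.Finite R M] [Module.Finite R P] [Module.Finite R N]
        [Nontrivial M] [Nontrivial P] [Nontrivial N]
        (φ : M →ₗ[R] P) (ψ : P →ₗ[R] N),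
        Function.Injective φ → Function.Exact φ ψ → Function.Surjective ψ →
        IsKoszulModule R P →
        LinearMap.range φ ≤ IsLocalRing.maximalIdeal R • (⊤ : Submodule R P) →
        projDim R N = max (projDim R M + 1) (projDim R P)) ∧
    -- small inclusions, over a standard graded algebra
    (∀ (k : Type w) [Field k] (R : Type u) [CommRing R] [Algebra k R]
        (𝒜 : ℤ → Submodule k R) [GradedAlgebra 𝒜]
        (M P N : Type u) [AddCommGroup M] [AddCommGroup P] [AddCommGroup N]
        [Module R M] [Module R P] [Module R N]
        [Module.Finite R M] [Module.Finite R P] [Module.Finite R N]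
        [Nontrivial M] [Nontrivial P] [Nontrivial N]
        (gM : ℤ → AddSubgroup M) [DirectSum.Decomposition gM] [SetLike.GradedSMul 𝒜 gM]
        (gP : ℤ → AddSubgroup P) [DirectSum.Decomposition gP] [SetLike.GradedSMul 𝒜 gP]
        (gN : ℤ → AddSubgroup N) [DirectSum.Decomposition gN] [SetLike.GradedSMul 𝒜 gN]
        (φ : M →ₗ[R] P) (ψ : P →ₗ[R] N),
        IsStandardGraded 𝒜 →
        (∀ j, ∀ x ∈ gM j, φ x ∈ gP j) → (∀ j, ∀ x ∈ gP j, ψ x ∈ gN j) →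
        Function.Injective φ → Function.Exact φ ψ → Function.Surjective ψ →
        IsGradedKoszulModule 𝒜 gP →
        LinearMap.range φ ≤ gradedMaxIdeal 𝒜 • (⊤ : Submodule R P) →
        projDim R N = max (projDim R M + 1) (projDim R P) ∧
        regularity 𝒜 gN = max (regularity 𝒜 gM - 1) (regularity 𝒜 gP)) := by
  refine ⟨?_, ?_, ?_, ?_⟩
  · intro R _ _ _ M P N _ _ _ _ _ _ _ _ _ _ _ _ φ ψ hinj hexact hsurj hK hpure
    have hR := gradedLocal_maximalIdeal R
    obtain ⟨F, hF⟩ := exists_minimal_homogRes hR (compat_trivial R M)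
    obtain ⟨H, hH⟩ := exists_minimal_homogRes hR (compat_trivial R N)
    obtain ⟨B, hB, h⟩ := exists_homogRes_of_pure hR (compat_trivial R P) (homog_trivial φ)
      (homog_trivial ψ) hinj hexact hsurj F hF (hK.isStrict _ hF) H hH hpure
    exact projDim_eq_max_of_hasDeg hR.ne_top hF hH hB h
  · intro k _ R _ _ 𝒜 _ M P N _ _ _ _ _ _ _ _ _ _ _ _ gM _ _ gP _ _ gN _ _ φ ψ hA hφ hψ hinj
      hexact hsurj hK hpure
    have hR := hA.gradedLocal
    have := hA.isNoetherianRing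
    obtain ⟨F, hF⟩ := exists_minimal_homogRes hR (compat_ofDecomposition 𝒜 gM)
    obtain ⟨H, hH⟩ := exists_minimal_homogRes hR (compat_ofDecomposition 𝒜 gN)
    obtain ⟨B, hB, h⟩ := exists_homogRes_of_pure hR (compat_ofDecomposition 𝒜 gP)
      (homog_ofDecomposition hφ) (homog_ofDecomposition hψ) hinj hexact hsurj F hF
      (hK.isStrict _ hF) H hH hpure
    exact ⟨projDim_eq_max_of_hasDeg hR.ne_top hF hH hB h,
      regularity_eq_max_of_hasDeg hA hF hH hB h⟩
  · intro R _ _ _ M P N _ _ _ _ _ _ _ _ _ _ _ _ φ ψ hinj hexact hsurj hK hsmall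
    have hR := gradedLocal_maximalIdeal R
    obtain ⟨F, hF⟩ := exists_minimal_homogRes hR (compat_trivial R P)
    obtain ⟨G, hG⟩ := exists_minimal_homogRes hR (compat_trivial R M)
    obtain ⟨B, hB, h0, h⟩ := exists_homogRes_of_small hR (homog_trivial φ) (homog_trivial ψ)
      hinj hexact hsurj F hF (hK.isStrict _ hF) G hG hsmall
    exact projDim_eq_max_add_one_of_hasDeg hR.ne_top hF hG hB h0 h
  · intro k _ R _ _ 𝒜 _ M P N _ _ _ _ _ _ _ _ _ _ _ _ gM _ _ gP _ _ gN _ _ φ ψ hA hφ hψ hinj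
      hexact hsurj hK hsmall
    have hR := hA.gradedLocal
    have := hA.isNoetherianRing
    obtain ⟨F, hF⟩ := exists_minimal_homogRes hR (compat_ofDecomposition 𝒜 gP)
    obtain ⟨G, hG⟩ := exists_minimal_homogRes hR (compat_ofDecomposition 𝒜 gM)
    obtain ⟨B, hB, h0, h⟩ := exists_homogRes_of_small hR (homog_ofDecomposition hφ)
      (homog_ofDecomposition hψ) hinj hexact hsurj F hF (hK.isStrict _ hF) G hG hsmall
    exact ⟨projDim_eq_max_add_one_of_hasDeg hR.ne_top hF hG hB h0 h,
      regularity_eq_max_sub_one_of_hasDeg hA hF hG hB h0 h⟩
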